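/- **Theorem (Propagation of chaos).** Let $\Theta=\prod_{b=1}^{B}\mathbb{R}^{m_b\times n_b}$ with the norm $\|\theta\|^2=\sum_b\|\theta^{(b)}\|_F^2$, let $\mathcal Z=\Theta\times\Theta$ with $\|(\theta,p)\|^2=\|\theta\|^2+\|p\|^2$, and let $\mathcal H$ be a real Hilbert space. Let $F:\Theta\to\mathcal H$ and $\mathcal R:\mathcal H\to\mathbb R$ be Fréchet differentiable, with $F$ Lipschitz, $DF$ bounded and Lipschitz, and $\nabla\mathcal R$ bounded and Lipschitz (all globally). Fix $\varepsilon,\gamma>0$. For a matrix with reduced singular value decomposition $P=U\operatorname{diag}(\sigma_1,\dots,\sigma_s)V^\top$ put $\operatorname{Orth}_\varepsilon(P)=U\operatorname{diag}\big(\sigma_i/\sqrt{\sigma_i^2+\varepsilon^2}\big)V^\top$, and let $\operatorname{Orth}_\varepsilon^\Theta$ act on $\Theta$ blockwise. Let $\mu_0$ be a probability measure on $\mathcal Z$ with finite second moment. On one probability space let $(\bar\theta_i,\bar P_i)_{i\ge1}$ be i.i.d. processes on $[0,\infty)$ with initial law $\mu_0$ that solve the nonlinear mean-field system $$\dot{\bar\theta}_i=-\operatorname{Orth}_\varepsilon^\Theta(\bar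 P_i),\qquad \dot{\bar P}_i=\gamma\big(DF(\bar\theta_i)^*\nabla\mathcal R(\mathbb E F(\bar\theta_i(t)))-\bar P_i\big),$$ and let $\mu_t$ be their common law at time $t$. For every $N\ge1$ let $(\theta_i^N,P_i^N)_{i\le N}$ solve the particle system $$\dot\theta_i^N=-\operatorname{Orth}_\varepsilon^\Theta(P_i^N),\qquad \dot P_i^N=\gamma\Big(DF(\theta_i^N)^*\nabla\mathcal R\Big(\tfrac1N\sum_{j=1}^N F(\theta_j^N)\Big)-P_i^N\Big),$$ with the same initial data $(\theta_i^N(0),P_i^N(0))=(\bar\theta_i(0),\bar P_i(0))$. Then for every $T<\infty$ there is a finite constant $C=C(T,\varepsilon)$ (depending also on $F,\mathcal R,\gamma,\mu_0$, but not on $N$, $i$, $k$ or the probability space) such that the following hold. 1. For all $N\ge1$ and $i\le N$, $\displaystyle\sup_{0\le t\le T}\mathbb E\big[\|\theta_i^N(t)-\bar\theta_i(t)\|^2+\|P_i^N(t)-\bar P_i(t)\|^2\big]\le\frac{C}{N}.$ 2. For all $k$, all $N\ge1$ and all distinct indices $i_1,\dots,i_k\le N$, $\displaystyle\sup_{0\le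 t\le T}W_2^2\big(\operatorname{Law}\big((\theta_{i_j}^N(t),P_{i_j}^N(t))_{j\le k}\big),\mu_t^{\otimes k}\big)\le\frac{kC}{N}$, where $\mathcal Z^k$ carries the product Hilbert norm. Consequently any $k$ fixed particles converge to $\mu_t^{\otimes k}$ as $N\to\infty$, in $W_2$ uniformly on $[0,T]$, and in law for each $t\in[0,T]$. 3. For $\mu_t^N=\frac1N\sum_{i\le N}\delta_{(\theta_i^N(t),P_i^N(t))}$ and $\bar\mu_t^N=\frac1N\sum_{i\le N}\delta_{(\bar\theta_i(t),\bar P_i(t))}$, $N\ge 1$, $$\sup_{0\le t\le T}\mathbb E\,W_2^2(\mu_t^N,\mu_t)\le\frac{2C}{N}+2\sup_{0\le t\le T}\mathbb E\,W_2^2(\bar\mu_t^N,\mu_t),$$ the second term on the right tends to $0$ as $N\to\infty$, and hence $\sup_{0\le t\le T}\mathbb E\,W_2^2(\mu_t^N,\mu_t)\to0$. The case $B=1$, $\mathcal H=\mathbb R$ is the scalar matrix setting, in which $DF(W)^*\nabla\mathcal R(u)=\mathcal R'(u)\nabla F(W)$. -/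

import Mathlib

open MeasureTheory ProbabilityTheory Filter Topology
open scoped ENNReal NNReal

/-! ### Parameter space and phase space -/

/-- The product parameter space `Θ = ∏_b ℝ^{m_b × n_b}`. A point is the family of all entries of
all blocks, so the Euclidean inner product is the sum over the blocks of the Frobenius inner
products (see `norm_sq_eq_sum_blocks`). -/
abbrev ParamSpace (B : ℕ) (m n : Fin B → ℕ) : Type :=
  EuclideanSpace ℝ ((b : Fin B) × (Fin (m b) × Fin (n b)))

/-- The `b`-th matrix block `θ^{(b)}` of `θ`. -/
def block {B : ℕ} {m n : Fin B → ℕ} (θ : ParamSpace B m n) (b : Fin B) :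
    Matrix (Fin (m b)) (Fin (n b)) ℝ :=
  Matrix.of fun i j => θ ⟨b, (i, j)⟩

/-- The point of `Θ` with prescribed matrix blocks. -/
noncomputable def ofBlocks {B : ℕ} {m n : Fin B → ℕ}
    (M : (b : Fin B) → Matrix (Fin (m b)) (Fin (n b)) ℝ) : ParamSpace B m n :=
  WithLp.toLp 2 fun x => M x.1 x.2.1 x.2.2

theorem block_ofBlocks {B : ℕ} {m n : Fin B → ℕ}
    (M : (b : Fin B) → Matrix (Fin (m b)) (Fin (n b)) ℝ) (b : Fin B) :
    block (ofBlocks M) b = M b := rfl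

/-- The norm of `Θ` is the square root of the sum of the squared Frobenius norms of the blocks. -/
theorem norm_sq_eq_sum_blocks {B : ℕ} {m n : Fin B → ℕ} (θ : ParamSpace B m n) :
    ‖θ‖ ^ 2 = ∑ b, ∑ i, ∑ j, (block θ b i j) ^ 2 := by
  rw [EuclideanSpace.norm_sq_eq, Fintype.sum_sigma]
  refine Finset.sum_congr rfl fun b _ => ?_
  rw [Fintype.sum_prod_type]
  simp [block]

/-- The phase space `Z = Θ × Θ` of pairs `(θ, p)`, with the Hilbert norm
`‖(θ, p)‖² = ‖θ‖² + ‖p‖²`. -/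
abbrev PhaseSpace (B : ℕ) (m n : Fin B → ℕ) : Type :=
  WithLp 2 (ParamSpace B m n × ParamSpace B m n)

/-! ### The regularized orthogonalization map -/

/-- The regularized orthogonalization `Orth_ε(P) = P (Pᵀ P + ε² I)^{-1/2}`. In terms of a reduced
singular value decomposition `P = U diag(σ) Vᵀ` this is `U diag(σ / √(σ² + ε²)) Vᵀ`
(see `orthEps_eq_of_svd`). -/
noncomputable def orthEps {k l : ℕ} (ε : ℝ) (P : Matrix (Fin k) (Fin l) ℝ) :
    Matrix (Fin k) (Fin l) ℝ :=
  P * cfc (fun x : ℝ => (Real.sqrt (x + ε ^ 2))⁻¹) (P.transpose * P)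

theorem orthEps_eq_of_svd {k l s : ℕ} (ε : ℝ) (P : Matrix (Fin k) (Fin l) ℝ)
    (U : Matrix (Fin k) (Fin s) ℝ) (V : Matrix (Fin l) (Fin s) ℝ) (σ : Fin s → ℝ)
    (hU : U.transpose * U = 1) (hV : V.transpose * V = 1)
    (hP : P = U * Matrix.diagonal σ * V.transpose) :
    orthEps ε P =
      U * Matrix.diagonal (fun i => σ i / Real.sqrt (σ i ^ 2 + ε ^ 2)) * V.transpose := by
  classical
  set f : ℝ → ℝ := fun x => (Real.sqrt (x + ε ^ 2))⁻¹ with hf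
  set A := P.transpose * P with hA
  have hAs : IsSelfAdjoint A := by
    have := Matrix.isHermitian_conjTranspose_mul_self P
    rw [Matrix.conjTranspose_eq_transpose_of_trivial] at this
    exact this
  -- an interpolating polynomial on the finitely many relevant points
  have hfin : (spectrum ℝ A).Finite := Matrix.finite_real_spectrum
  set S : Finset ℝ := hfin.toFinset ∪ Finset.univ.image (fun i => σ i ^ 2) with hS
  set p : Polynomial ℝ := Lagrange.interpolate S id f with hp
  have hpS : ∀ x ∈ S, p.eval x = f x := fun x hx =>
    Lagrange.eval_interpolate_at_node f (Function.injective_id.injOn) hx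
  have hcfc : cfc f A = Polynomial.aeval A p := by
    rw [← cfc_polynomial p A hAs]
    refine cfc_congr fun x hx => ?_
    exact (hpS x (by simp [hS, hx])).symm
  have hVA : V.transpose * A = Matrix.diagonal (fun i => σ i ^ 2) * V.transpose := by
    rw [hA, hP]
    simp only [Matrix.transpose_mul, Matrix.transpose_transpose, Matrix.diagonal_transpose]
    calc V.transpose * (V * (Matrix.diagonal σ * U.transpose) *
          (U * Matrix.diagonal σ * V.transpose))
        = (V.transpose * V) * Matrix.diagonal σ * (U.transpose * U) * Matrix.diagonal σ *
          V.transpose := by simp only [Matrix.mul_assoc]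
      _ = _ := by
        rw [hU, hV, Matrix.one_mul, Matrix.mul_one, Matrix.diagonal_mul_diagonal]
        simp only [pow_two]
  have hpoly : ∀ q : Polynomial ℝ, V.transpose * Polynomial.aeval A q =
      Matrix.diagonal (fun i => q.eval (σ i ^ 2)) * V.transpose := by
    intro q
    induction q using Polynomial.induction_on' with
    | add q r hq hr =>
      rw [map_add, Matrix.mul_add, hq, hr, ← Matrix.add_mul, Matrix.diagonal_add]
      simp only [Polynomial.eval_add]
    | monomial d a =>
      have hpow : ∀ d : ℕ, V.transpose * A ^ d =
          Matrix.diagonal (fun i => (σ i ^ 2) ^ d) * V.transpose := by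
        intro d
        induction d with
        | zero => simp
        | succ d ih =>
          rw [pow_succ, ← Matrix.mul_assoc, ih, Matrix.mul_assoc, hVA, ← Matrix.mul_assoc,
            Matrix.diagonal_mul_diagonal]
          simp only [← pow_succ]
      rw [Polynomial.aeval_monomial, ← Algebra.smul_def, Matrix.mul_smul, hpow, ← Matrix.smul_mul,
        ← Matrix.diagonal_smul]
      congr 2
      funext i
      simp
  have key := hpoly p
  rw [orthEps, ← hA, hcfc]
  conv_lhs => rw [hP]
  rw [Matrix.mul_assoc, key, ← Matrix.mul_assoc, Matrix.mul_assoc U, Matrix.diagonal_mul_diagonal]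
  congr 3
  funext i
  rw [hpS _ (by simp [hS]), hf, div_eq_mul_inv]

/-- The blockwise map `Orth_ε^Θ(p) = (Orth_ε(p^{(1)}), …, Orth_ε(p^{(B)}))`. -/
noncomputable def orthTheta {B : ℕ} {m n : Fin B → ℕ} (ε : ℝ) (p : ParamSpace B m n) :
    ParamSpace B m n :=
  ofBlocks fun b => orthEps ε (block p b)

/-! ### Data of the problem and the characteristic system -/

/-- Global Hilbert smoothness of the feature map `F : Θ → H` and the outer loss `R : H → ℝ`:
both are (Fréchet) differentiable, `F` is Lipschitz, `DF` is bounded and Lipschitz, and `∇R` is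
bounded and Lipschitz. -/
structure GlobalHilbertSmooth {B : ℕ} {m n : Fin B → ℕ} {H : Type*} [NormedAddCommGroup H]
    [InnerProductSpace ℝ H] [CompleteSpace H] (F : ParamSpace B m n → H) (R : H → ℝ) : Prop where
  differentiable_F : Differentiable ℝ F
  differentiable_R : Differentiable ℝ R
  lipschitz_F : ∃ L : ℝ, ∀ θ ϑ, ‖F θ - F ϑ‖ ≤ L * ‖θ - ϑ‖
  bounded_DF : ∃ M : ℝ, ∀ θ, ‖fderiv ℝ F θ‖ ≤ M
  lipschitz_DF : ∃ L : ℝ, ∀ θ ϑ, ‖fderiv ℝ F θ - fderiv ℝ F ϑ‖ ≤ L * ‖θ - ϑ‖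
  bounded_gradR : ∃ M : ℝ, ∀ z, ‖gradient R z‖ ≤ M
  lipschitz_gradR : ∃ L : ℝ, ∀ z z', ‖gradient R z - gradient R z'‖ ≤ L * ‖z - z'‖

/-- The force `DF(θ)^* ∇R(u)`, where `u` stands for the current mean feature. -/
noncomputable def force {B : ℕ} {m n : Fin B → ℕ} {H : Type*} [NormedAddCommGroup H]
    [InnerProductSpace ℝ H] [CompleteSpace H] (F : ParamSpace B m n → H) (R : H → ℝ)
    (u : H) (θ : ParamSpace B m n) : ParamSpace B m n :=
  ContinuousLinearMap.adjoint (fderiv ℝ F θ) (gradient R u)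

/-- The path `z = (θ, p) : [0, ∞) → Z` solves, in the presence of the mean feature `u(t)`,
`θ' = - Orth_ε^Θ(p)`, `p' = γ (DF(θ)^* ∇R(u(t)) - p)` (with one-sided derivatives at `0`). -/
def SolvesCharacteristic {B : ℕ} {m n : Fin B → ℕ} {H : Type*} [NormedAddCommGroup H]
    [InnerProductSpace ℝ H] [CompleteSpace H] (F : ParamSpace B m n → H) (R : H → ℝ)
    (ε γ : ℝ) (u : ℝ → H) (z : ℝ → PhaseSpace B m n) : Prop :=
  ∀ t, 0 ≤ t →
    HasDerivWithinAt (fun s => (z s).fst) (-orthTheta ε (z t).snd) (Set.Ici 0) t ∧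
    HasDerivWithinAt (fun s => (z s).snd) (γ • (force F R (u t) (z t).fst - (z t).snd))
      (Set.Ici 0) t

/-! ### Particle system and nonlinear copies -/

/-- `x : [0, ∞) → Z^N` solves the `N`-particle ODE
`θ_i' = - Orth_ε^Θ(P_i)`, `P_i' = γ (DF(θ_i)^* ∇R(N⁻¹ ∑_j F(θ_j)) - P_i)`, `i = 1, …, N`. -/
def SolvesParticleODE {B : ℕ} {m n : Fin B → ℕ} {H : Type*} [NormedAddCommGroup H]
    [InnerProductSpace ℝ H] [CompleteSpace H] (F : ParamSpace B m n → H) (R : H → ℝ)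
    (ε γ : ℝ) {N : ℕ} (x : Fin N → ℝ → PhaseSpace B m n) : Prop :=
  ∀ i, SolvesCharacteristic F R ε γ (fun t => (N : ℝ)⁻¹ • ∑ j, F (x j t).fst) (x i)

/-- The process `Y` solves, almost surely, the nonlinear mean-field characteristic system
`θ' = - Orth_ε^Θ(P)`, `P' = γ (DF(θ)^* ∇R(E F(θ_t)) - P)` on `[0, ∞)`. -/
def SolvesMeanField {B : ℕ} {m n : Fin B → ℕ} {H : Type*} [NormedAddCommGroup H]
    [InnerProductSpace ℝ H] [CompleteSpace H] (F : ParamSpace B m n → H) (R : H → ℝ)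
    (ε γ : ℝ) {Ω : Type*} [MeasurableSpace Ω] (Pr : Measure Ω)
    (Y : ℝ → Ω → PhaseSpace B m n) : Prop :=
  ∀ᵐ ω ∂Pr, SolvesCharacteristic F R ε γ (fun t => ∫ ω', F (Y t ω').fst ∂Pr) (fun t => Y t ω)

/-- Synchronous coupling on one probability space `(Ω, Pr)`. The processes `Y 0, Y 1, …` are i.i.d.
nonlinear mean-field copies with initial law `μ₀`; for every `N`, the processes
`X N 0, …, X N (N - 1)` solve the `N`-particle ODE and start from the same initial data as
`Y 0, …, Y (N - 1)`. All times are nonnegative. -/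
structure IsSynchronousCoupling {B : ℕ} {m n : Fin B → ℕ} {H : Type*} [NormedAddCommGroup H]
    [InnerProductSpace ℝ H] [CompleteSpace H] (F : ParamSpace B m n → H) (R : H → ℝ)
    (ε γ : ℝ) (μ₀ : Measure (PhaseSpace B m n)) {Ω : Type*} [MeasurableSpace Ω] (Pr : Measure Ω)
    (Y : ℕ → ℝ → Ω → PhaseSpace B m n)
    (X : (N : ℕ) → Fin N → ℝ → Ω → PhaseSpace B m n) : Prop where
  measurable_copy : ∀ i t, 0 ≤ t → Measurable (Y i t)
  measurable_particle : ∀ N i t, 0 ≤ t → Measurable (X N i t)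
  indep_copies : iIndepFun (fun i ω (t : ℝ≥0) => Y i t ω) Pr
  identDistrib_copies : ∀ i,
    IdentDistrib (fun ω (t : ℝ≥0) => Y i t ω) (fun ω (t : ℝ≥0) => Y 0 t ω) Pr Pr
  initial_law : Pr.map (Y 0 0) = μ₀
  copy_solves : ∀ i, SolvesMeanField F R ε γ Pr (Y i)
  particle_solves : ∀ N, ∀ᵐ ω ∂Pr, SolvesParticleODE F R ε γ (fun i t => X N i t ω)
  same_initial_data : ∀ N (i : Fin N), ∀ᵐ ω ∂Pr, X N i 0 ω = Y i 0 ω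

/-! ### Wasserstein distance, empirical and product measures -/

/-- The squared quadratic Wasserstein distance `W₂²(μ, ν)`: the infimum of the quadratic transport
cost over all couplings of `μ` and `ν`. -/
noncomputable def wasserstein2Sq {E : Type*} [MeasurableSpace E] [EDist E] (μ ν : Measure E) :
    ℝ≥0∞ :=
  ⨅ (π : Measure (E × E)) (_ : π.map Prod.fst = μ ∧ π.map Prod.snd = ν),
    ∫⁻ z, edist z.1 z.2 ^ 2 ∂π

/-- The empirical measure `N⁻¹ ∑_i δ_{x_i}`. -/
noncomputable def empiricalMeasure {E : Type*} [MeasurableSpace E] {N : ℕ} (x : Fin N → E) :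
    Measure E :=
  (N : ℝ≥0∞)⁻¹ • ∑ i, Measure.dirac (x i)

/-- The product measure `μ^{⊗k}` on `E^k` with its `ℓ²` product metric. -/
noncomputable def tensorPower {E : Type*} [MeasurableSpace E] (μ : Measure E) (k : ℕ) :
    Measure (PiLp 2 fun _ : Fin k => E) :=
  (Measure.pi fun _ : Fin k => μ).map (WithLp.toLp 2)

/-!
The particles and the nonlinear copies are compared path by path, and the only source of randomness
in the comparison is the law of large numbers for the features `F(θ̄_j)`.

* The vector field is globally Lipschitz. For the regularized orthogonalization
  (`frobSq_orthEps_sub_le`) this is seen on the symmetric dilation of a matrix: there it becomes the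
  functional calculus of the Lipschitz function `x / √(x² + ε²)`, and a Lipschitz function of
  symmetric matrices is Lipschitz in the Frobenius norm (`frobSq_cfc_sub_le`).
* For almost every realization, Grönwall's inequality bounds the squared distance of the `i`-th
  particle to its copy by a constant times the time integral of the squared fluctuation
  `‖N⁻¹ ∑_j F(θ̄_j) - E F(θ̄)‖²` (`SolvesParticleODE.norm_sub_sq_le`). The
  expected fluctuation is at most `V / N` because the copies are independent
  (`integral_norm_average_sub_sq_le`), and Tonelli's theorem gives the coupling estimate
  (`IsSynchronousCoupling.lintegral_edist_sq_le`).
* The synchronous coupling of `k` particles with `k` copies bounds the Wasserstein distance to the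
  product measure, and its convergence in `L²` gives convergence in law.
* For the empirical measures, the triangle inequality for `W₂` (`wasserstein2Sq_triangle`, by gluing
  of couplings) reduces the claim to the independent copies. At a fixed time, a quantization of the
  state space reduces it further to the convergence of finitely many empirical frequencies
  (`tendsto_lintegral_wasserstein2Sq_empiricalMeasure`). The copies are Lipschitz in time in
  quadratic mean, so the convergence is uniform on the compact interval `[0, T]`.
-/

/-! ### Lipschitz continuity of the regularized orthogonalization -/

/-- The squared Frobenius norm of a real matrix. -/
def frobSq {ι κ : Type*} [Fintype ι] [Fintype κ] (M : Matrix ι κ ℝ) : ℝ :=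
  ∑ i, ∑ j, M i j ^ 2

theorem frobSq_eq_trace {ι κ : Type*} [Fintype ι] [Fintype κ] (M : Matrix ι κ ℝ) :
    frobSq M = (M.transpose * M).trace := by
  rw [frobSq, Finset.sum_comm]
  simp [Matrix.trace, Matrix.mul_apply, pow_two]

theorem frobSq_orthogonal_conj {ι : Type*} [Fintype ι] [DecidableEq ι] {U V : Matrix ι ι ℝ}
    (hU : U * U.transpose = 1) (hV : V * V.transpose = 1) (M : Matrix ι ι ℝ) :
    frobSq (U.transpose * M * V) = frobSq M := by
  rw [frobSq_eq_trace, frobSq_eq_trace]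
  have : (U.transpose * M * V).transpose * (U.transpose * M * V)
      = V.transpose * (M.transpose * (U * U.transpose) * M * V) := by
    simp only [Matrix.transpose_mul, Matrix.transpose_transpose, Matrix.mul_assoc]
  rw [this, hU, Matrix.trace_mul_comm, Matrix.mul_one, Matrix.mul_assoc _ V, hV, Matrix.mul_one]

theorem exists_orthogonal_diagonalization {ι : Type*} [Fintype ι] [DecidableEq ι]
    {A : Matrix ι ι ℝ} (hA : A.transpose = A) :
    ∃ (U : Matrix ι ι ℝ) (a : ι → ℝ), U.transpose * U = 1 ∧ U * U.transpose = 1 ∧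
      ∀ f : ℝ → ℝ, cfc f A = U * Matrix.diagonal (fun i => f (a i)) * U.transpose := by
  have hA' : A.IsHermitian := by
    rw [Matrix.IsHermitian, Matrix.conjTranspose_eq_transpose_of_trivial, hA]
  refine ⟨hA'.eigenvectorUnitary, hA'.eigenvalues, ?_, ?_, fun f => ?_⟩
  · have := Unitary.coe_star_mul_self hA'.eigenvectorUnitary
    rwa [Matrix.star_eq_conjTranspose, Matrix.conjTranspose_eq_transpose_of_trivial] at this
  · have := Unitary.coe_mul_star_self hA'.eigenvectorUnitary
    rwa [Unitary.coe_star, Matrix.star_eq_conjTranspose,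
      Matrix.conjTranspose_eq_transpose_of_trivial] at this
  · rw [hA'.cfc_eq, Matrix.IsHermitian.cfc, Unitary.conjStarAlgAut_apply,
      Matrix.star_eq_conjTranspose, Matrix.conjTranspose_eq_transpose_of_trivial]
    rfl

/-- A Lipschitz function acts on symmetric matrices as a Lipschitz map for the Frobenius norm:
in eigenbases `u_i` of `A` and `v_j` of `B`, the entries of `f(A) - f(B)` are
`(f(a_i) - f(b_j)) ⟨u_i, v_j⟩`, those of `A - B` are `(a_i - b_j) ⟨u_i, v_j⟩`. -/
theorem frobSq_cfc_sub_le {ι : Type*} [Fintype ι] [DecidableEq ι] {A B : Matrix ι ι ℝ}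
    (hA : A.transpose = A) (hB : B.transpose = B) {f : ℝ → ℝ} {L : ℝ}
    (hf : ∀ x y, |f x - f y| ≤ L * |x - y|) :
    frobSq (cfc f A - cfc f B) ≤ L ^ 2 * frobSq (A - B) := by
  obtain ⟨U, a, hU, hU', ha⟩ := exists_orthogonal_diagonalization hA
  obtain ⟨V, b, hV, hV', hb⟩ := exists_orthogonal_diagonalization hB
  have hsa : ∀ {C : Matrix ι ι ℝ}, C.transpose = C → IsSelfAdjoint C := fun {C} hC => by
    rw [IsSelfAdjoint, Matrix.star_eq_conjTranspose,
      Matrix.conjTranspose_eq_transpose_of_trivial, hC]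
  have key : ∀ g : ℝ → ℝ, frobSq (cfc g A - cfc g B) =
      ∑ i, ∑ j, ((g (a i) - g (b j)) * (U.transpose * V) i j) ^ 2 := by
    intro g
    rw [← frobSq_orthogonal_conj hU' hV', frobSq]
    have : U.transpose * (cfc g A - cfc g B) * V =
        Matrix.diagonal (fun i => g (a i)) * (U.transpose * V) -
          (U.transpose * V) * Matrix.diagonal (fun i => g (b i)) := by
      rw [ha, hb, Matrix.mul_sub, Matrix.sub_mul]
      congr 1
      · simp only [← Matrix.mul_assoc]
        rw [hU, Matrix.one_mul]
      · simp only [Matrix.mul_assoc]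
        rw [hV, Matrix.mul_one]
    simp only [this, Matrix.sub_apply, Matrix.diagonal_mul, Matrix.mul_diagonal]
    refine Finset.sum_congr rfl fun i _ => Finset.sum_congr rfl fun j _ => ?_
    ring
  have hid := key id
  rw [cfc_id ℝ A (hsa hA), cfc_id ℝ B (hsa hB)] at hid
  rw [key, hid, Finset.mul_sum]
  refine Finset.sum_le_sum fun i _ => ?_
  rw [Finset.mul_sum]
  refine Finset.sum_le_sum fun j _ => ?_
  rw [mul_pow, mul_pow, ← mul_assoc]
  refine mul_le_mul_of_nonneg_right ?_ (sq_nonneg _)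
  calc (f (a i) - f (b j)) ^ 2 = |f (a i) - f (b j)| ^ 2 := (sq_abs _).symm
    _ ≤ (L * |a i - b j|) ^ 2 := pow_le_pow_left₀ (abs_nonneg _) (hf _ _) 2
    _ = _ := by rw [mul_pow, sq_abs]; rfl

theorem frobSq_cfc_le {ι : Type*} [Fintype ι] [DecidableEq ι] {A : Matrix ι ι ℝ}
    (hA : A.transpose = A) {f : ℝ → ℝ} {M : ℝ} (hf : ∀ x, |f x| ≤ M) :
    frobSq (cfc f A) ≤ Fintype.card ι * M ^ 2 := by
  obtain ⟨U, a, hU, hU', ha⟩ := exists_orthogonal_diagonalization hA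
  have : U.transpose * cfc f A * U = Matrix.diagonal (fun i => f (a i)) := by
    rw [ha]
    simp only [Matrix.mul_assoc]
    rw [hU, Matrix.mul_one, ← Matrix.mul_assoc, hU, Matrix.one_mul]
  rw [← frobSq_orthogonal_conj hU' hU', this, frobSq]
  calc ∑ i, ∑ j, Matrix.diagonal (fun i => f (a i)) i j ^ 2 = ∑ i, f (a i) ^ 2 := by
        refine Finset.sum_congr rfl fun i _ => ?_
        rw [Finset.sum_eq_single i (fun j _ hj => by rw [Matrix.diagonal_apply_ne' _ hj]; simp)
          (by simp), Matrix.diagonal_apply_eq]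
    _ ≤ ∑ _i : ι, M ^ 2 := Finset.sum_le_sum fun i _ => by
        rw [← sq_abs]; exact pow_le_pow_left₀ (abs_nonneg _) (hf _) 2
    _ = _ := by simp

/-- The scalar profile `x / √(x² + ε²)` of the regularized orthogonalization. -/
noncomputable def orthProfile (ε x : ℝ) : ℝ := x * (Real.sqrt (x ^ 2 + ε ^ 2))⁻¹

theorem abs_orthProfile_le_one (ε x : ℝ) : |orthProfile ε x| ≤ 1 := by
  rw [orthProfile, abs_mul, abs_inv, abs_of_nonneg (Real.sqrt_nonneg _), ← div_eq_mul_inv]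
  refine div_le_one_of_le₀ ?_ (Real.sqrt_nonneg _)
  exact Real.abs_le_sqrt (by nlinarith [sq_nonneg ε])

theorem abs_orthProfile_sub_le {ε : ℝ} (hε : 0 < ε) (x y : ℝ) :
    |orthProfile ε x - orthProfile ε y| ≤ 2 / ε * |x - y| := by
  set a := Real.sqrt (x ^ 2 + ε ^ 2) with ha
  set b := Real.sqrt (y ^ 2 + ε ^ 2) with hb
  have ha2 : a ^ 2 = x ^ 2 + ε ^ 2 := Real.sq_sqrt (by positivity)
  have hb2 : b ^ 2 = y ^ 2 + ε ^ 2 := Real.sq_sqrt (by positivity)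
  have hεa : ε ≤ a := Real.le_sqrt_of_sq_le (by nlinarith [sq_nonneg x])
  have hxa : |x| ≤ a := Real.abs_le_sqrt (by nlinarith [sq_nonneg ε])
  have hyb : |y| ≤ b := Real.abs_le_sqrt (by nlinarith [sq_nonneg ε])
  have hεb : ε ≤ b := Real.le_sqrt_of_sq_le (by nlinarith [sq_nonneg y])
  have ha0 : 0 < a := hε.trans_le hεa
  have hb0 : 0 < b := hε.trans_le hεb
  have hab : |b - a| ≤ |x - y| := by
    have h1 : (b - a) * (b + a) = (y - x) * (y + x) := by nlinarith
    have h2 : |b - a| * (b + a) ≤ |x - y| * (b + a) := by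
      calc |b - a| * (b + a) = |(b - a) * (b + a)| := by
            rw [abs_mul, abs_of_pos (add_pos hb0 ha0)]
        _ = |x - y| * |y + x| := by rw [h1, abs_mul, abs_sub_comm]
        _ ≤ |x - y| * (b + a) := mul_le_mul_of_nonneg_left
            ((abs_add_le _ _).trans (add_le_add hyb hxa)) (abs_nonneg _)
    exact le_of_mul_le_mul_right h2 (add_pos hb0 ha0)
  have hdec : orthProfile ε x - orthProfile ε y = a⁻¹ * ((x - y) + y * b⁻¹ * (b - a)) := by
    rw [orthProfile, orthProfile, ← ha, ← hb]
    field_simp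
    ring
  have hy1 : |y * b⁻¹| ≤ 1 := abs_orthProfile_le_one ε y
  rw [hdec, abs_mul, abs_inv, abs_of_pos ha0]
  have h3 : |x - y + y * b⁻¹ * (b - a)| ≤ 2 * |x - y| := by
    refine (abs_add_le _ _).trans ?_
    rw [abs_mul]
    nlinarith [mul_le_mul hy1 hab (abs_nonneg _) zero_le_one]
  calc a⁻¹ * |x - y + y * b⁻¹ * (b - a)| ≤ ε⁻¹ * (2 * |x - y|) :=
        mul_le_mul (inv_anti₀ hε hεa) h3 (abs_nonneg _) (by positivity)
    _ = _ := by ring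

/-- The symmetric dilation `[[0, P], [Pᵀ, 0]]` of a rectangular matrix `P`. -/
def dilation {k l : ℕ} (P : Matrix (Fin k) (Fin l) ℝ) :
    Matrix (Fin k ⊕ Fin l) (Fin k ⊕ Fin l) ℝ :=
  Matrix.fromBlocks 0 P P.transpose 0

theorem dilation_transpose {k l : ℕ} (P : Matrix (Fin k) (Fin l) ℝ) :
    (dilation P).transpose = dilation P := by
  simp [dilation, Matrix.fromBlocks_transpose]

/-- The regularized orthogonalization is the off-diagonal block of a scalar function of the
symmetric dilation. -/
theorem cfc_dilation_toBlocks₁₂ {k l : ℕ} (ε : ℝ) (P : Matrix (Fin k) (Fin l) ℝ) :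
    (cfc (orthProfile ε) (dilation P)).toBlocks₁₂ = orthEps ε P := by
  classical
  set g : ℝ → ℝ := fun x => (Real.sqrt (x + ε ^ 2))⁻¹ with hg
  set A := P.transpose * P with hA
  set Z := dilation P with hZ
  have hAs : IsSelfAdjoint A := by
    have := Matrix.isHermitian_conjTranspose_mul_self P
    rw [Matrix.conjTranspose_eq_transpose_of_trivial] at this
    exact this
  have hZs : IsSelfAdjoint Z := by
    rw [IsSelfAdjoint, Matrix.star_eq_conjTranspose,
      Matrix.conjTranspose_eq_transpose_of_trivial, hZ, dilation_transpose]
  -- one polynomial that represents `g` on both spectra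
  have hfinA : (spectrum ℝ A).Finite := Matrix.finite_real_spectrum
  have hfinZ : (spectrum ℝ Z).Finite := Matrix.finite_real_spectrum
  set S : Finset ℝ := hfinA.toFinset ∪ hfinZ.toFinset.image (fun x => x ^ 2) with hS
  set p : Polynomial ℝ := Lagrange.interpolate S id g with hp
  have hpS : ∀ x ∈ S, p.eval x = g x := fun x hx =>
    Lagrange.eval_interpolate_at_node g (Function.injective_id.injOn) hx
  have hcA : cfc g A = Polynomial.aeval A p := by
    rw [← cfc_polynomial p A hAs]
    exact cfc_congr fun x hx => (hpS x (by simp [hS, hx])).symm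
  have hcZ : cfc (orthProfile ε) Z = Z * Polynomial.aeval (Z ^ 2) p := by
    have h1 : Z * Polynomial.aeval (Z ^ 2) p =
        Polynomial.aeval Z (Polynomial.X * p.comp (Polynomial.X ^ 2)) := by
      simp [Polynomial.aeval_comp]
    rw [h1, ← cfc_polynomial _ Z hZs]
    refine cfc_congr fun x hx => ?_
    have : p.eval (x ^ 2) = g (x ^ 2) :=
      hpS _ (by
        rw [hS, Finset.mem_union]
        exact Or.inr (Finset.mem_image_of_mem _ (by simpa using hx)))
    simp [Polynomial.eval_comp, this, orthProfile, hg]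
  have hZ2 : Z ^ 2 = Matrix.fromBlocks (P * P.transpose) 0 0 A := by
    rw [pow_two, hZ, dilation, Matrix.fromBlocks_multiply]
    simp [hA]
  have hpoly : ∀ q : Polynomial ℝ, Polynomial.aeval (Z ^ 2) q =
      Matrix.fromBlocks (Polynomial.aeval (P * P.transpose) q) 0 0 (Polynomial.aeval A q) := by
    intro q
    rw [hZ2]
    induction q using Polynomial.induction_on' with
    | add q r hq hr => simp [hq, hr, Matrix.fromBlocks_add]
    | monomial d a =>
      rw [Polynomial.aeval_monomial, Polynomial.aeval_monomial, Polynomial.aeval_monomial,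
        ← Algebra.smul_def, ← Algebra.smul_def, ← Algebra.smul_def,
        Matrix.fromBlocks_diagonal_pow, Matrix.fromBlocks_smul]
      simp
  rw [orthEps, ← hA, hcZ, hpoly, hcA, hZ, dilation, Matrix.fromBlocks_multiply]
  simp

theorem frobSq_toBlocks₁₂_le {k l : ℕ} (M : Matrix (Fin k ⊕ Fin l) (Fin k ⊕ Fin l) ℝ) :
    frobSq M.toBlocks₁₂ ≤ frobSq M := by
  simp only [frobSq, Fintype.sum_sum_type, Matrix.toBlocks₁₂, Matrix.of_apply]
  have h : ∀ a b : ℝ, 0 ≤ a → 0 ≤ b → b ≤ a + b := fun a b ha _ => by linarith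
  refine (Finset.sum_le_sum fun i _ => h (∑ j, M (Sum.inl i) (Sum.inl j) ^ 2) _
    (by positivity) (by positivity)).trans (le_add_of_nonneg_right (by positivity))

theorem frobSq_dilation {k l : ℕ} (P : Matrix (Fin k) (Fin l) ℝ) :
    frobSq (dilation P) = 2 * frobSq P := by
  simp only [frobSq, dilation, Fintype.sum_sum_type, Matrix.fromBlocks_apply₁₁,
    Matrix.fromBlocks_apply₁₂, Matrix.fromBlocks_apply₂₁, Matrix.fromBlocks_apply₂₂,
    Matrix.transpose_apply, Matrix.zero_apply]
  have h : ∑ x : Fin l, ∑ y : Fin k, P y x ^ 2 = ∑ y : Fin k, ∑ x : Fin l, P y x ^ 2 :=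
    Finset.sum_comm
  simp [h, two_mul]

theorem frobSq_orthEps_sub_le {k l : ℕ} {ε : ℝ} (hε : 0 < ε) (P Q : Matrix (Fin k) (Fin l) ℝ) :
    frobSq (orthEps ε P - orthEps ε Q) ≤ (2 / ε) ^ 2 * 2 * frobSq (P - Q) := by
  have h1 : orthEps ε P - orthEps ε Q =
      (cfc (orthProfile ε) (dilation P) - cfc (orthProfile ε) (dilation Q)).toBlocks₁₂ := by
    rw [← cfc_dilation_toBlocks₁₂, ← cfc_dilation_toBlocks₁₂]; rfl
  have h2 : dilation P - dilation Q = dilation (P - Q) := by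
    simp [dilation, sub_eq_add_neg, Matrix.fromBlocks_add, Matrix.fromBlocks_neg]
  rw [h1, mul_assoc, ← frobSq_dilation, ← h2]
  exact (frobSq_toBlocks₁₂_le _).trans (frobSq_cfc_sub_le (dilation_transpose P)
    (dilation_transpose Q) (abs_orthProfile_sub_le hε))

theorem frobSq_orthEps_le {k l : ℕ} (ε : ℝ) (P : Matrix (Fin k) (Fin l) ℝ) :
    frobSq (orthEps ε P) ≤ k + l := by
  rw [← cfc_dilation_toBlocks₁₂]
  refine (frobSq_toBlocks₁₂_le _).trans ((frobSq_cfc_le (dilation_transpose P)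
    (abs_orthProfile_le_one ε)).trans ?_)
  simp

theorem norm_sq_eq_sum_frobSq {B : ℕ} {m n : Fin B → ℕ} (θ : ParamSpace B m n) :
    ‖θ‖ ^ 2 = ∑ b, frobSq (block θ b) := norm_sq_eq_sum_blocks θ

theorem exists_lipschitz_orthTheta {B : ℕ} {m n : Fin B → ℕ} {ε : ℝ} (hε : 0 < ε) :
    ∃ L : ℝ, 0 ≤ L ∧ ∀ p q : ParamSpace B m n, ‖orthTheta ε p - orthTheta ε q‖ ≤ L * ‖p - q‖ := by
  refine ⟨Real.sqrt ((2 / ε) ^ 2 * 2), Real.sqrt_nonneg _, fun p q => ?_⟩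
  refine le_of_sq_le_sq ?_ (by positivity)
  rw [mul_pow, Real.sq_sqrt (by positivity), norm_sq_eq_sum_frobSq, norm_sq_eq_sum_frobSq,
    Finset.mul_sum]
  exact Finset.sum_le_sum fun b _ => frobSq_orthEps_sub_le hε (block p b) (block q b)

theorem exists_bound_orthTheta {B : ℕ} (m n : Fin B → ℕ) (ε : ℝ) :
    ∃ K : ℝ, 0 ≤ K ∧ ∀ p : ParamSpace B m n, ‖orthTheta ε p‖ ≤ K := by
  refine ⟨Real.sqrt (∑ b, ((m b : ℝ) + n b)), Real.sqrt_nonneg _, fun p => ?_⟩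
  refine le_of_sq_le_sq ?_ (by positivity)
  rw [Real.sq_sqrt (by positivity), norm_sq_eq_sum_frobSq]
  exact Finset.sum_le_sum fun b _ => frobSq_orthEps_le ε (block p b)

/-! ### Quadratic Wasserstein distance -/

theorem ENNReal.add_sq_le_two_mul (a b : ℝ≥0∞) : (a + b) ^ 2 ≤ 2 * a ^ 2 + 2 * b ^ 2 := by
  have := ENNReal.rpow_add_le_mul_rpow_add_rpow a b (p := 2) (by norm_num)
  norm_num at this
  rwa [mul_add] at this

theorem wasserstein2Sq_le_of_coupling {E : Type*} [MeasurableSpace E] [EDist E] {μ ν : Measure E}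
    (π : Measure (E × E)) (h₁ : π.map Prod.fst = μ) (h₂ : π.map Prod.snd = ν) :
    wasserstein2Sq μ ν ≤ ∫⁻ z, edist z.1 z.2 ^ 2 ∂π :=
  iInf₂_le π ⟨h₁, h₂⟩

theorem wasserstein2Sq_map_le {E : Type*} [MeasurableSpace E] [EDist E] {Ω : Type*}
    [MeasurableSpace Ω] (P : Measure Ω) {f g : Ω → E} (hf : Measurable f) (hg : Measurable g) :
    wasserstein2Sq (P.map f) (P.map g) ≤ ∫⁻ ω, edist (f ω) (g ω) ^ 2 ∂P :=
  (wasserstein2Sq_le_of_coupling (P.map fun ω => (f ω, g ω))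
    (by rw [Measure.map_map measurable_fst (hf.prodMk hg)]; rfl)
    (by rw [Measure.map_map measurable_snd (hf.prodMk hg)]; rfl)).trans (lintegral_map_le _ _)

/-- Triangle inequality for the squared distance. A coupling of `μ, ν` and a coupling of `ν, ρ`
are disintegrated along `ν` and glued so that the outer variables are conditionally independent
given the middle one. -/
theorem wasserstein2Sq_triangle {E : Type*} [MeasurableSpace E] [PseudoEMetricSpace E]
    [StandardBorelSpace E] [OpensMeasurableSpace E] [SecondCountableTopology E] [Nonempty E]
    (μ ν ρ : Measure E) [IsFiniteMeasure ν] :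
    wasserstein2Sq μ ρ ≤ 2 * wasserstein2Sq μ ν + 2 * wasserstein2Sq ν ρ := by
  have hμν : wasserstein2Sq μ ν = ⨅ π : {π : Measure (E × E) // π.map Prod.fst = μ ∧
      π.map Prod.snd = ν}, ∫⁻ z, edist z.1 z.2 ^ 2 ∂π.1 := by rw [iInf_subtype]; rfl
  have hνρ : wasserstein2Sq ν ρ = ⨅ π : {π : Measure (E × E) // π.map Prod.fst = ν ∧
      π.map Prod.snd = ρ}, ∫⁻ z, edist z.1 z.2 ^ 2 ∂π.1 := by rw [iInf_subtype]; rfl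
  rw [hμν, hνρ, ENNReal.mul_iInf_of_ne two_ne_zero ENNReal.ofNat_ne_top,
    ENNReal.mul_iInf_of_ne two_ne_zero ENNReal.ofNat_ne_top]
  refine ENNReal.le_iInf_add_iInf fun ⟨π, hπ₁, hπ₂⟩ ⟨τ, hτ₁, hτ₂⟩ => ?_
  have hc : Measurable fun z : E × E => edist z.1 z.2 ^ 2 := measurable_edist.pow_const 2
  set π' := π.map Prod.swap with hπ'
  have hfst' : π'.fst = ν := by
    rw [Measure.fst, hπ', Measure.map_map measurable_fst measurable_swap, ← hπ₂]; rfl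
  have hfstτ : τ.fst = ν := hτ₁
  have : IsFiniteMeasure π' := ⟨by
    rw [← Measure.fst_univ, hfst']; exact measure_lt_top _ _⟩
  have : IsFiniteMeasure τ := ⟨by
    rw [← Measure.fst_univ, hfstτ]; exact measure_lt_top _ _⟩
  have hdπ : ν ⊗ₘ π'.condKernel = π' := by
    rw [← hfst']; exact Measure.disintegrate π' π'.condKernel
  have hdτ : ν ⊗ₘ τ.condKernel = τ := by
    conv_lhs => rw [← hfstτ]
    exact Measure.disintegrate τ τ.condKernel
  set W := ν ⊗ₘ (π'.condKernel ×ₖ τ.condKernel) with hW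
  have hW₁ : W.map (Prod.map id Prod.fst) = π' := by
    rw [hW, ← Measure.compProd_map measurable_fst, ← Kernel.fst_eq, Kernel.fst_prod, hdπ]
  have hW₂ : W.map (Prod.map id Prod.snd) = τ := by
    rw [hW, ← Measure.compProd_map measurable_snd, ← Kernel.snd_eq, Kernel.snd_prod, hdτ]
  have hm₁ : Measurable (Prod.map id Prod.fst : E × (E × E) → E × E) :=
    measurable_id.prodMap measurable_fst
  have hm₂ : Measurable (Prod.map id Prod.snd : E × (E × E) → E × E) :=
    measurable_id.prodMap measurable_snd
  refine (wasserstein2Sq_le_of_coupling (W.map Prod.snd) ?_ ?_).trans ?_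
  · rw [Measure.map_map measurable_fst measurable_snd, ← hπ₁,
      show π = π'.map Prod.swap by
        rw [hπ', Measure.map_map measurable_swap measurable_swap]; simp,
      ← hW₁, Measure.map_map measurable_swap hm₁,
      Measure.map_map measurable_fst (measurable_swap.comp hm₁)]
    rfl
  · rw [Measure.map_map measurable_snd measurable_snd, ← hτ₂, ← hW₂,
      Measure.map_map measurable_snd hm₂]
    rfl
  · rw [lintegral_map hc measurable_snd]
    have h₁ : ∫⁻ z, edist z.1 z.2 ^ 2 ∂π = ∫⁻ w, edist w.2.1 w.1 ^ 2 ∂W := by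
      rw [show π = π'.map Prod.swap by
        rw [hπ', Measure.map_map measurable_swap measurable_swap]; simp,
        lintegral_map hc measurable_swap, ← hW₁]
      exact lintegral_map (hc.comp measurable_swap) hm₁
    have h₂ : ∫⁻ z, edist z.1 z.2 ^ 2 ∂τ = ∫⁻ w, edist w.1 w.2.2 ^ 2 ∂W := by
      conv_lhs => rw [← hW₂]
      rw [lintegral_map hc hm₂]
      rfl
    simp only [h₁, h₂]
    have hc₁ : Measurable fun w : E × (E × E) => 2 * edist w.2.1 w.1 ^ 2 :=
      ((hc.comp measurable_swap).comp hm₁).const_mul 2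
    rw [← lintegral_const_mul' _ _ ENNReal.ofNat_ne_top,
      ← lintegral_const_mul' _ _ ENNReal.ofNat_ne_top, ← lintegral_add_left hc₁]
    refine lintegral_mono fun w => ?_
    exact (pow_le_pow_left₀ zero_le (edist_triangle _ w.1 _) 2).trans
      (ENNReal.add_sq_le_two_mul _ _)

theorem empiricalMeasure_map {E E' : Type*} [MeasurableSpace E] [MeasurableSpace E'] {N : ℕ}
    (x : Fin N → E) {f : E → E'} (hf : Measurable f) :
    (empiricalMeasure x).map f = empiricalMeasure fun i => f (x i) := by
  rw [empiricalMeasure, empiricalMeasure, Measure.map_smul, Measure.map_finset_sum hf.aemeasurable]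
  simp [Measure.map_dirac' hf]

theorem lintegral_empiricalMeasure {E : Type*} [MeasurableSpace E] {N : ℕ}
    (x : Fin N → E) {f : E → ℝ≥0∞} (hf : Measurable f) :
    ∫⁻ z, f z ∂(empiricalMeasure x) = (N : ℝ≥0∞)⁻¹ * ∑ i, f (x i) := by
  rw [empiricalMeasure, lintegral_smul_measure, lintegral_finsetSum_measure]
  simp [lintegral_dirac' _ hf]

theorem isProbabilityMeasure_empiricalMeasure {E : Type*} [MeasurableSpace E] {N : ℕ}
    (hN : 1 ≤ N) (x : Fin N → E) : IsProbabilityMeasure (empiricalMeasure x) := ⟨by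
  have hN0 : (N : ℝ≥0∞) ≠ 0 := by exact_mod_cast (Nat.one_le_iff_ne_zero.mp hN)
  simp [empiricalMeasure, ENNReal.inv_mul_cancel hN0 (ENNReal.natCast_ne_top N)]⟩

theorem wasserstein2Sq_empiricalMeasure_le {E : Type*} [MeasurableSpace E] [PseudoEMetricSpace E]
    [OpensMeasurableSpace E] [SecondCountableTopology E] {N : ℕ} (x y : Fin N → E) :
    wasserstein2Sq (empiricalMeasure x) (empiricalMeasure y) ≤
      (N : ℝ≥0∞)⁻¹ * ∑ i, edist (x i) (y i) ^ 2 := by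
  refine (wasserstein2Sq_le_of_coupling (empiricalMeasure fun i => (x i, y i))
    (empiricalMeasure_map _ measurable_fst) (empiricalMeasure_map _ measurable_snd)).trans ?_
  rw [lintegral_empiricalMeasure _ (measurable_edist.pow_const 2)]

/-- Two measures with the common part `κ` and remainders of equal mass: the common part stays in
place, and the remainders are coupled by their normalized product. -/
theorem wasserstein2Sq_add_le {E : Type*} [MeasurableSpace E] [NormedAddCommGroup E]
    [OpensMeasurableSpace E] [SecondCountableTopology E] (κ ν' μ' : Measure E)
    [IsFiniteMeasure ν'] [IsFiniteMeasure μ'] (hmass : ν' Set.univ = μ' Set.univ) :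
    wasserstein2Sq (κ + ν') (κ + μ') ≤
      2 * ∫⁻ x, ‖x‖ₑ ^ 2 ∂ν' + 2 * ∫⁻ x, ‖x‖ₑ ^ 2 ∂μ' := by
  have hc : Measurable fun z : E × E => edist z.1 z.2 ^ 2 := measurable_edist.pow_const 2
  have hn : Measurable fun z : E => ‖z‖ₑ ^ 2 := measurable_enorm.pow_const 2
  have hdiag : Measurable fun x : E => (x, x) := measurable_id.prodMk measurable_id
  set r := ν' Set.univ with hr
  -- For `r = 0`, where `r⁻¹ = ∞`, both remainders vanish.
  have hcancel : r⁻¹ • r • ν' = ν' ∧ r⁻¹ • r • μ' = μ' := by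
    rcases eq_or_ne r 0 with h0 | h0
    · have h1 : ν' = 0 := Measure.measure_univ_eq_zero.mp (hr ▸ h0)
      have h2 : μ' = 0 := Measure.measure_univ_eq_zero.mp (hmass ▸ h0)
      simp [h1, h2]
    · rw [smul_smul, smul_smul, ENNReal.inv_mul_cancel h0 (measure_ne_top _ _), one_smul, one_smul]
      exact ⟨rfl, rfl⟩
  have hint : ∀ {σ : Measure E}, r⁻¹ • r • σ = σ → ∀ f : E → ℝ≥0∞,
      r⁻¹ * (r * ∫⁻ x, f x ∂σ) = ∫⁻ x, f x ∂σ := fun {σ} hσ f => by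
    conv_rhs => rw [← hσ]
    simp [lintegral_smul_measure]
  refine (wasserstein2Sq_le_of_coupling
    (κ.map (fun x => (x, x)) + r⁻¹ • ν'.prod μ') ?_ ?_).trans ?_
  · rw [Measure.map_add _ _ measurable_fst, Measure.map_map measurable_fst hdiag,
      Measure.map_smul, Measure.map_fst_prod, ← hmass, hcancel.1]
    congr 1
    exact Measure.map_id
  · rw [Measure.map_add _ _ measurable_snd, Measure.map_map measurable_snd hdiag,
      Measure.map_smul, Measure.map_snd_prod, ← hr, hcancel.2]
    congr 1
    exact Measure.map_id
  · rw [lintegral_add_measure, lintegral_map hc hdiag, lintegral_smul_measure,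
      lintegral_prod _ hc.aemeasurable]
    simp only [edist_self, ne_eq, OfNat.ofNat_ne_zero, not_false_eq_true, zero_pow, lintegral_zero,
      zero_add, smul_eq_mul]
    calc r⁻¹ * ∫⁻ x, ∫⁻ y, edist x y ^ 2 ∂μ' ∂ν'
        ≤ r⁻¹ * ∫⁻ x, ∫⁻ y, (2 * ‖x‖ₑ ^ 2 + 2 * ‖y‖ₑ ^ 2) ∂μ' ∂ν' := by
          gcongr with x y
          refine le_trans ?_ (ENNReal.add_sq_le_two_mul _ _)
          gcongr
          rw [edist_eq_enorm_sub]
          exact enorm_sub_le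
      _ = r⁻¹ * (r * ∫⁻ x, 2 * ‖x‖ₑ ^ 2 ∂ν') + r⁻¹ * (r * ∫⁻ y, 2 * ‖y‖ₑ ^ 2 ∂μ') := by
          simp only [lintegral_add_left measurable_const, lintegral_const]
          rw [lintegral_add_right _ measurable_const, lintegral_const,
            lintegral_mul_const'' _ (hn.const_mul 2).aemeasurable, ← hr, ← hmass]
          ring
      _ = _ := by
          rw [hint hcancel.1, hint hcancel.2, lintegral_const_mul _ hn, lintegral_const_mul _ hn]

theorem SimpleFunc.map_measure_eq_sum_dirac {E E' : Type*} [MeasurableSpace E] [MeasurableSpace E']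
    (Q : SimpleFunc E E') (hQ : Measurable Q) (ν : Measure E) :
    ν.map Q = ∑ z ∈ Q.range, ν (Q ⁻¹' {z}) • Measure.dirac z := by
  classical
  ext s hs
  have h1 := SimpleFunc.map_lintegral (μ := ν) (s.indicator (fun _ => (1 : ℝ≥0∞))) Q
  rw [← SimpleFunc.lintegral_eq_lintegral] at h1
  rw [Measure.map_apply hQ hs, ← lintegral_indicator_one (hQ hs)]
  simp only [Measure.coe_finsetSum, Finset.sum_apply, Measure.smul_apply,
    Measure.dirac_apply' _ hs, smul_eq_mul]
  refine Eq.trans ?_ (h1.trans (Finset.sum_congr rfl fun z _ => mul_comm _ _))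
  rfl

/-- Two laws that are carried by the same finite set: mass which need not move stays in place. -/
theorem wasserstein2Sq_map_simpleFunc_le {E : Type*} [MeasurableSpace E] [NormedAddCommGroup E]
    [BorelSpace E] [SecondCountableTopology E] (Q : SimpleFunc E E) (ν μ : Measure E)
    [IsProbabilityMeasure ν] [IsProbabilityMeasure μ] :
    wasserstein2Sq (ν.map Q) (μ.map Q) ≤
      2 * ∑ z ∈ Q.range, ((ν (Q ⁻¹' {z}) - μ (Q ⁻¹' {z})) +
        (μ (Q ⁻¹' {z}) - ν (Q ⁻¹' {z}))) * ‖z‖ₑ ^ 2 := by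
  have hn : Measurable fun z : E => ‖z‖ₑ ^ 2 := measurable_enorm.pow_const 2
  set a : E → ℝ≥0∞ := fun z => ν (Q ⁻¹' {z}) with ha
  set b : E → ℝ≥0∞ := fun z => μ (Q ⁻¹' {z}) with hb
  have hat : ∀ z, a z ≠ ∞ := fun z => measure_ne_top _ _
  have hbt : ∀ z, b z ≠ ∞ := fun z => measure_ne_top _ _
  have hsplit : ∀ a b : E → ℝ≥0∞, ∑ z ∈ Q.range, a z • Measure.dirac z =
      ∑ z ∈ Q.range, min (a z) (b z) • Measure.dirac z +
        ∑ z ∈ Q.range, (a z - b z) • Measure.dirac z := fun a b => by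
    rw [← Finset.sum_add_distrib]
    refine Finset.sum_congr rfl fun z _ => ?_
    rw [← add_smul, add_comm, tsub_add_min]
  have hν : ν.map Q = ∑ z ∈ Q.range, min (a z) (b z) • Measure.dirac z +
        ∑ z ∈ Q.range, (a z - b z) • Measure.dirac z := by
    rw [SimpleFunc.map_measure_eq_sum_dirac Q Q.measurable ν]; exact hsplit a b
  have hμ : μ.map Q = ∑ z ∈ Q.range, min (a z) (b z) • Measure.dirac z +
        ∑ z ∈ Q.range, (b z - a z) • Measure.dirac z := by
    rw [SimpleFunc.map_measure_eq_sum_dirac Q Q.measurable μ]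
    simp only [min_comm (a _)]
    exact hsplit b a
  have hfin : ∀ c : E → ℝ≥0∞, (∀ z, c z ≠ ∞) →
      IsFiniteMeasure (∑ z ∈ Q.range, c z • Measure.dirac z) := fun c hc => ⟨by
    simp [ENNReal.sum_lt_top, (hc _).lt_top]⟩
  have := hfin (fun z => a z - b z) fun z => ENNReal.sub_ne_top (hat z)
  have := hfin (fun z => b z - a z) fun z => ENNReal.sub_ne_top (hbt z)
  have := hfin (fun z => min (a z) (b z)) fun z => ne_top_of_le_ne_top (hat z) (min_le_left _ _)
  have hmass : (∑ z ∈ Q.range, (a z - b z) • Measure.dirac z) Set.univ =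
      (∑ z ∈ Q.range, (b z - a z) • Measure.dirac z) Set.univ := by
    have h1 : (ν.map Q) Set.univ = 1 := by
      rw [Measure.map_apply Q.measurable .univ]; simp
    have h2 : (μ.map Q) Set.univ = 1 := by
      rw [Measure.map_apply Q.measurable .univ]; simp
    rw [hν, Measure.add_apply] at h1
    rw [hμ, Measure.add_apply, ← h1] at h2
    exact ((ENNReal.add_right_inj (measure_ne_top _ _)).mp h2).symm
  rw [hν, hμ]
  refine (wasserstein2Sq_add_le _ _ _ hmass).trans (le_of_eq ?_)
  simp only [lintegral_finsetSum_measure, lintegral_smul_measure, lintegral_dirac' _ hn,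
    smul_eq_mul, add_mul, Finset.sum_add_distrib, mul_add]
  rfl

/-! ### Averages of independent copies -/

theorem integrable_norm_sq_of_memLp {Ω : Type*} [MeasurableSpace Ω] {P : Measure Ω} {H : Type*}
    [NormedAddCommGroup H] {f : Ω → H} (hf : MemLp f 2 P) : Integrable (fun ω => ‖f ω‖ ^ 2) P :=
  (memLp_two_iff_integrable_sq_norm hf.1).mp hf

theorem integrable_inner_of_memLp {Ω : Type*} [MeasurableSpace Ω] {P : Measure Ω} {H : Type*}
    [NormedAddCommGroup H] [InnerProductSpace ℝ H] {f g : Ω → H} (hf : MemLp f 2 P)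
    (hg : MemLp g 2 P) : Integrable (fun ω => inner ℝ (f ω) (g ω)) P := by
  refine ((integrable_norm_sq_of_memLp hf).add (integrable_norm_sq_of_memLp hg)).mono'
    (hf.1.inner hg.1) (Eventually.of_forall fun ω => ?_)
  refine (norm_inner_le_norm _ _).trans ?_
  simp only [Pi.add_apply]
  nlinarith [sq_nonneg (‖f ω‖ - ‖g ω‖), sq_nonneg (‖f ω‖), sq_nonneg (‖g ω‖)]

/-- The variance of an average of `N` pairwise independent Hilbert space valued variables with
common mean is at most `V / N`: the covariances of distinct summands vanish. -/
theorem integral_norm_average_sub_sq_le {Ω : Type*} [MeasurableSpace Ω] {P : Measure Ω}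
    [IsProbabilityMeasure P] {H : Type*} [NormedAddCommGroup H] [InnerProductSpace ℝ H]
    [CompleteSpace H] [MeasurableSpace H] [BorelSpace H] {N : ℕ} (hN : 1 ≤ N) {ξ : Fin N → Ω → H}
    (hξ : ∀ i, MemLp (ξ i) 2 P) (hind : ∀ i j, i ≠ j → IndepFun (ξ i) (ξ j) P) {c : H}
    (hc : ∀ i, ∫ ω, ξ i ω ∂P = c) {V : ℝ} (hV : ∀ i, ∫ ω, ‖ξ i ω‖ ^ 2 ∂P ≤ V) :
    Integrable (fun ω => ‖(N : ℝ)⁻¹ • ∑ i, ξ i ω - c‖ ^ 2) P ∧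
      ∫ ω, ‖(N : ℝ)⁻¹ • ∑ i, ξ i ω - c‖ ^ 2 ∂P ≤ V / N := by
  have hN0 : (N : ℝ) ≠ 0 := by exact_mod_cast Nat.one_le_iff_ne_zero.mp hN
  set η : Fin N → Ω → H := fun i ω => ξ i ω - c with hη
  have hηL : ∀ i, MemLp (η i) 2 P := fun i => (hξ i).sub (memLp_const c)
  have hξI : ∀ i, Integrable (ξ i) P := fun i => (hξ i).integrable one_le_two
  have hηI : ∀ i, Integrable (η i) P := fun i => (hηL i).integrable one_le_two
  have hη0 : ∀ i, ∫ ω, η i ω ∂P = 0 := fun i => by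
    rw [hη, integral_sub (hξI i) (integrable_const c), hc]; simp
  have hsq : ∀ ω, ‖(N : ℝ)⁻¹ • ∑ i, ξ i ω - c‖ ^ 2 =
      ((N : ℝ)⁻¹) ^ 2 * ∑ i, ∑ j, inner ℝ (η i ω) (η j ω) := fun ω => by
    have h1 : (N : ℝ)⁻¹ • ∑ i, ξ i ω - c = (N : ℝ)⁻¹ • ∑ i, η i ω := by
      simp only [hη, Finset.sum_sub_distrib, Finset.sum_const, Finset.card_univ, Fintype.card_fin,
        smul_sub]
      rw [← Nat.cast_smul_eq_nsmul ℝ, smul_smul, inv_mul_cancel₀ hN0, one_smul]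
    rw [h1, norm_smul, mul_pow, Real.norm_eq_abs, sq_abs, ← real_inner_self_eq_norm_sq, sum_inner]
    simp only [inner_sum]
  have hI : ∀ i j, Integrable (fun ω => inner ℝ (η i ω) (η j ω)) P := fun i j =>
    integrable_inner_of_memLp (hηL i) (hηL j)
  have hsumI : Integrable (fun ω => ∑ i, ∑ j, inner ℝ (η i ω) (η j ω)) P :=
    integrable_finsetSum _ fun i _ => integrable_finsetSum _ fun j _ => hI i j
  simp only [hsq]
  refine ⟨hsumI.const_mul _, ?_⟩
  have hoff : ∀ i j, i ≠ j → ∫ ω, inner ℝ (η i ω) (η j ω) ∂P = 0 := fun i j hij => by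
    have hm : Measurable fun x : H => x - c := (continuous_id.sub continuous_const).measurable
    have := ((hind i j hij).comp hm hm).integral_bilin (hηI i) (hηI j) (innerSL ℝ)
    have h0 : ∫ ω, ((fun x : H => x - c) ∘ ξ i) ω ∂P = 0 := hη0 i
    rw [h0, map_zero] at this
    exact this
  have hdiag : ∀ i, ∫ ω, inner ℝ (η i ω) (η i ω) ∂P ≤ V := fun i => by
    have h1 : ∀ ω, inner ℝ (η i ω) (η i ω) =
        ‖ξ i ω‖ ^ 2 - 2 * inner ℝ c (ξ i ω) + ‖c‖ ^ 2 := fun ω => by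
      rw [real_inner_self_eq_norm_sq, hη, norm_sub_sq_real, real_inner_comm]
    have h2 : Integrable (fun ω => inner ℝ c (ξ i ω)) P := (hξI i).const_inner c
    have h3 : Integrable (fun ω => ‖ξ i ω‖ ^ 2 - 2 * inner ℝ c (ξ i ω)) P :=
      (integrable_norm_sq_of_memLp (hξ i)).sub (h2.const_mul 2)
    simp only [h1]
    rw [integral_add h3 (integrable_const _),
      integral_sub (integrable_norm_sq_of_memLp (hξ i)) (h2.const_mul 2),
      integral_const_mul, integral_inner (hξI i), hc, real_inner_self_eq_norm_sq]
    simp only [integral_const, probReal_univ, one_smul]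
    nlinarith [hV i, sq_nonneg ‖c‖]
  rw [integral_const_mul, integral_finsetSum _ fun i _ =>
    integrable_finsetSum _ fun j _ => hI i j]
  have hle : ∑ i, ∫ ω, ∑ j, inner ℝ (η i ω) (η j ω) ∂P ≤ N * V := by
    calc ∑ i, ∫ ω, ∑ j, inner ℝ (η i ω) (η j ω) ∂P
        = ∑ i, ∫ ω, inner ℝ (η i ω) (η i ω) ∂P := Finset.sum_congr rfl fun i _ => by
          rw [integral_finsetSum _ fun j _ => hI i j]
          exact Finset.sum_eq_single i (fun j _ hj => hoff i j hj.symm) (by simp)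
      _ ≤ ∑ _i : Fin N, V := Finset.sum_le_sum fun i _ => hdiag i
      _ = N * V := by simp
  calc ((N : ℝ)⁻¹) ^ 2 * ∑ i, ∫ ω, ∑ j, inner ℝ (η i ω) (η j ω) ∂P
      ≤ ((N : ℝ)⁻¹) ^ 2 * (N * V) := mul_le_mul_of_nonneg_left hle (by positivity)
    _ = V / N := by field_simp

theorem ENNReal.tsub_add_tsub_eq_enorm {a b : ℝ≥0∞} (ha : a ≠ ∞) (hb : b ≠ ∞) :
    (a - b) + (b - a) = ‖a.toReal - b.toReal‖ₑ := by
  rw [Real.enorm_eq_ofReal_abs]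
  rcases le_total a b with h | h
  · rw [tsub_eq_zero_of_le h, zero_add, abs_of_nonpos (sub_nonpos.mpr (ENNReal.toReal_mono hb h)),
      neg_sub, ENNReal.ofReal_sub _ ENNReal.toReal_nonneg, ENNReal.ofReal_toReal ha,
      ENNReal.ofReal_toReal hb]
  · rw [tsub_eq_zero_of_le h, add_zero, abs_of_nonneg (sub_nonneg.mpr (ENNReal.toReal_mono ha h)),
      ENNReal.ofReal_sub _ ENNReal.toReal_nonneg, ENNReal.ofReal_toReal ha,
      ENNReal.ofReal_toReal hb]

theorem empiricalMeasure_apply {E : Type*} [MeasurableSpace E] {N : ℕ} (x : Fin N → E) {A : Set E}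
    (hA : MeasurableSet A) :
    empiricalMeasure x A = (N : ℝ≥0∞)⁻¹ * ∑ i, A.indicator 1 (x i) := by
  simp [empiricalMeasure, Measure.dirac_apply' _ hA]

/-- The law of large numbers in `L¹` for the empirical frequency of a set. -/
theorem tendsto_lintegral_empiricalMeasure_tsub {E Ω : Type*} [MeasurableSpace E]
    [MeasurableSpace Ω] {P : Measure Ω} [IsProbabilityMeasure P] {Y : ℕ → Ω → E}
    (hY : ∀ i, Measurable (Y i)) (hind : ∀ i j, i ≠ j → IndepFun (Y i) (Y j) P)
    (hid : ∀ i, IdentDistrib (Y i) (Y 0) P P) {A : Set E} (hA : MeasurableSet A) :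
    Tendsto (fun N : ℕ => ∫⁻ ω, ((empiricalMeasure (fun i : Fin N => Y i ω) A - P.map (Y 0) A) +
      (P.map (Y 0) A - empiricalMeasure (fun i : Fin N => Y i ω) A)) ∂P) atTop (𝓝 0) := by
  have hf : Measurable (A.indicator (1 : E → ℝ)) := measurable_one.indicator hA
  have hlim := strong_law_Lp (μ := P) (p := 1) le_rfl ENNReal.one_ne_top
    (fun i ω => A.indicator (1 : E → ℝ) (Y i ω))
    (MemLp.of_bound (hf.comp (hY 0)).aestronglyMeasurable 1 (Eventually.of_forall fun ω => by
      by_cases h : Y 0 ω ∈ A <;> simp [h]))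
    (fun i j hij => (hind i j hij).comp hf hf) (fun i => (hid i).comp hf)
  refine hlim.congr' ?_
  filter_upwards [eventually_ge_atTop 1] with N hN
  rw [eLpNorm_one_eq_lintegral_enorm]
  refine lintegral_congr fun ω => ?_
  have := isProbabilityMeasure_empiricalMeasure hN (fun i : Fin N => Y i ω)
  have := Measure.isProbabilityMeasure_map (μ := P) (hY 0).aemeasurable
  rw [ENNReal.tsub_add_tsub_eq_enorm (measure_ne_top _ _) (measure_ne_top _ _)]
  congr 2
  · rw [empiricalMeasure_apply _ hA, ENNReal.toReal_mul, ENNReal.toReal_inv, ENNReal.toReal_natCast,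
      ENNReal.toReal_sum, Finset.sum_range, smul_eq_mul]
    · congr 1
      refine Finset.sum_congr rfl fun i _ => ?_
      by_cases h : Y i ω ∈ A <;> simp [h]
    · intro i _
      by_cases h : Y i ω ∈ A <;> simp [h]
  · rw [Measure.map_apply (hY 0) hA, ← Measure.real,
      ← integral_indicator_one (hY 0 hA)]
    rfl

theorem lintegral_enorm_sq_eq_eLpNorm_sq {Ω : Type*} [MeasurableSpace Ω] {P : Measure Ω}
    {H : Type*} [NormedAddCommGroup H] (f : Ω → H) :
    ∫⁻ ω, ‖f ω‖ₑ ^ 2 ∂P = eLpNorm f 2 P ^ 2 := by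
  rw [eLpNorm_eq_lintegral_rpow_enorm_toReal two_ne_zero ENNReal.ofNat_ne_top,
    ← ENNReal.rpow_natCast, ← ENNReal.rpow_mul]
  simp

/-- The expected squared Wasserstein distance between the empirical measure of i.i.d. variables
with finite second moment and their law tends to zero. A simple function `Q` close to the identity
in `L²(μ)` reduces the claim to finitely many empirical frequencies. -/
theorem tendsto_lintegral_wasserstein2Sq_empiricalMeasure {E Ω : Type*} [MeasurableSpace E]
    [NormedAddCommGroup E] [BorelSpace E] [SecondCountableTopology E] [StandardBorelSpace E]
    [MeasurableSpace Ω] {P : Measure Ω} [IsProbabilityMeasure P] {Y : ℕ → Ω → E}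
    (hY : ∀ i, Measurable (Y i)) (hind : ∀ i j, i ≠ j → IndepFun (Y i) (Y j) P)
    (hid : ∀ i, IdentDistrib (Y i) (Y 0) P P) (hL : MemLp (Y 0) 2 P) :
    Tendsto (fun N : ℕ => ∫⁻ ω, wasserstein2Sq (empiricalMeasure fun i : Fin N => Y i ω)
      (P.map (Y 0)) ∂P) atTop (𝓝 0) := by
  rw [ENNReal.tendsto_nhds_zero]
  intro δ hδ
  set μ := P.map (Y 0) with hμ
  have hμP : IsProbabilityMeasure μ := Measure.isProbabilityMeasure_map (hY 0).aemeasurable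
  have hidL : MemLp (id : E → E) 2 μ :=
    (memLp_map_measure_iff measurable_id.aestronglyMeasurable (hY 0).aemeasurable).mpr hL
  obtain ⟨Q, hQ, -⟩ := hidL.exists_simpleFunc_eLpNorm_sub_lt ENNReal.ofNat_ne_top
    (ε := min 1 (δ / 12)) (by simp [hδ.ne'])
  have hdm : Measurable fun z : E => edist z (Q z) ^ 2 :=
    (measurable_id.edist Q.measurable).pow_const 2
  set D := ∫⁻ z, edist z (Q z) ^ 2 ∂μ with hD
  have hDδ : D ≤ δ / 12 := by
    have h1 : D = eLpNorm (id - ⇑Q) 2 μ ^ 2 := by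
      rw [← lintegral_enorm_sq_eq_eLpNorm_sq, hD]
      simp [edist_eq_enorm_sub]
    rw [h1, pow_two]
    exact (mul_le_mul' (hQ.le.trans (min_le_left _ _)) (hQ.le.trans (min_le_right _ _))).trans
      (by rw [one_mul])
  set e : E → (N : ℕ) → Ω → ℝ≥0∞ := fun z N ω =>
    (empiricalMeasure (fun i : Fin N => Y i ω) (Q ⁻¹' {z}) - μ (Q ⁻¹' {z})) +
      (μ (Q ⁻¹' {z}) - empiricalMeasure (fun i : Fin N => Y i ω) (Q ⁻¹' {z})) with he
  have hem : ∀ z N, Measurable (e z N) := fun z N => by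
    have : Measurable fun ω => empiricalMeasure (fun i : Fin N => Y i ω) (Q ⁻¹' {z}) := by
      simp only [empiricalMeasure_apply _ (Q.measurableSet_fiber z)]
      have h1 : Measurable ((Q ⁻¹' {z}).indicator (1 : E → ℝ≥0∞)) :=
        measurable_one.indicator (Q.measurableSet_fiber z)
      have h2 : ∀ i ∈ (Finset.univ : Finset (Fin N)),
          Measurable fun ω => (Q ⁻¹' {z}).indicator (1 : E → ℝ≥0∞) (Y i ω) :=
        fun i _ => h1.comp (hY i)
      exact (Finset.measurable_sum _ h2).const_mul _
    exact (this.sub_const _).add (this.const_sub _)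
  have hlim : Tendsto (fun N : ℕ => 8 * ∑ z ∈ Q.range, (∫⁻ ω, e z N ω ∂P) * ‖z‖ₑ ^ 2) atTop
      (𝓝 0) := by
    have h1 : ∀ z ∈ Q.range, Tendsto (fun N : ℕ => (∫⁻ ω, e z N ω ∂P) * ‖z‖ₑ ^ 2) atTop (𝓝 0) :=
      fun z _ => by
        simpa using ENNReal.Tendsto.mul_const
          (tendsto_lintegral_empiricalMeasure_tsub hY hind hid (Q.measurableSet_fiber z))
          (Or.inr (ENNReal.pow_ne_top enorm_ne_top) : (0 : ℝ≥0∞) ≠ 0 ∨ ‖z‖ₑ ^ 2 ≠ ∞)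
    simpa using ENNReal.Tendsto.const_mul (tendsto_finsetSum _ h1)
      (Or.inr ENNReal.ofNat_ne_top : _ ∨ (8 : ℝ≥0∞) ≠ ∞)
  have hδ2 : 0 < δ / 2 := ENNReal.half_pos hδ.ne'
  filter_upwards [eventually_ge_atTop 1, (ENNReal.tendsto_nhds_zero.mp hlim) _ hδ2] with N hN hNδ
  have hN0 : (N : ℝ≥0∞) ≠ 0 := by exact_mod_cast Nat.one_le_iff_ne_zero.mp hN
  have hpt : ∀ ω, wasserstein2Sq (empiricalMeasure fun i : Fin N => Y i ω) μ ≤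
      2 * ((N : ℝ≥0∞)⁻¹ * ∑ i : Fin N, edist (Y i ω) (Q (Y i ω)) ^ 2) +
        2 * (2 * (2 * ∑ z ∈ Q.range, e z N ω * ‖z‖ₑ ^ 2) + 2 * D) := fun ω => by
    have hp := isProbabilityMeasure_empiricalMeasure hN (fun i : Fin N => Y i ω)
    have hp' := Measure.isProbabilityMeasure_map (μ := empiricalMeasure (fun i : Fin N => Y i ω))
      Q.measurable.aemeasurable
    have hp'' := Measure.isProbabilityMeasure_map (μ := μ) Q.measurable.aemeasurable
    refine (wasserstein2Sq_triangle _ ((empiricalMeasure fun i : Fin N => Y i ω).map Q) _).trans ?_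
    gcongr
    · rw [empiricalMeasure_map _ Q.measurable]
      exact wasserstein2Sq_empiricalMeasure_le _ _
    · refine (wasserstein2Sq_triangle _ (μ.map Q) _).trans ?_
      gcongr
      · exact wasserstein2Sq_map_simpleFunc_le Q _ _
      · have := wasserstein2Sq_map_le μ Q.measurable measurable_id
        rw [Measure.map_id] at this
        simpa only [edist_comm, id] using this
  have hmean : ∀ i, ∫⁻ ω, edist (Y i ω) (Q (Y i ω)) ^ 2 ∂P = D := fun i => by
    rw [hD, hμ, ← (hid i).map_eq, lintegral_map hdm (hY i)]
  have hm0 : ∀ i ∈ (Finset.univ : Finset (Fin N)),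
      Measurable fun ω => edist (Y i ω) (Q (Y i ω)) ^ 2 := fun i _ => hdm.comp (hY i)
  have hm1 : Measurable fun ω => 2 * ((N : ℝ≥0∞)⁻¹ * ∑ i : Fin N,
      edist (Y i ω) (Q (Y i ω)) ^ 2) :=
    ((Finset.measurable_sum _ hm0).const_mul _).const_mul _
  have hm2 : Measurable fun ω => ∑ z ∈ Q.range, e z N ω * ‖z‖ₑ ^ 2 :=
    Finset.measurable_sum _ fun z _ => (hem z N).mul_const _
  calc ∫⁻ ω, wasserstein2Sq (empiricalMeasure fun i : Fin N => Y i ω) μ ∂P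
      ≤ ∫⁻ ω, (2 * ((N : ℝ≥0∞)⁻¹ * ∑ i : Fin N, edist (Y i ω) (Q (Y i ω)) ^ 2) +
        2 * (2 * (2 * ∑ z ∈ Q.range, e z N ω * ‖z‖ₑ ^ 2) + 2 * D)) ∂P := lintegral_mono hpt
    _ = 2 * D + (8 * ∑ z ∈ Q.range, (∫⁻ ω, e z N ω ∂P) * ‖z‖ₑ ^ 2 + 4 * D) := by
        rw [lintegral_add_left hm1, lintegral_const_mul' _ _ ENNReal.ofNat_ne_top,
          lintegral_const_mul' _ _ (ENNReal.inv_ne_top.mpr hN0),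
          lintegral_finsetSum _ hm0,
          lintegral_const_mul' _ _ ENNReal.ofNat_ne_top, lintegral_add_right _ measurable_const,
          lintegral_const_mul' _ _ ENNReal.ofNat_ne_top,
          lintegral_const_mul' _ _ ENNReal.ofNat_ne_top,
          lintegral_finsetSum _ fun z _ => (hem z N).mul_const _]
        simp only [hmean, lintegral_mul_const _ (hem _ N), lintegral_const, measure_univ, mul_one,
          Finset.sum_const, Finset.card_univ, Fintype.card_fin, nsmul_eq_mul]
        rw [← mul_assoc (N : ℝ≥0∞)⁻¹, ENNReal.inv_mul_cancel hN0 (ENNReal.natCast_ne_top N)]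
        ring
    _ ≤ 2 * (δ / 12) + (δ / 2 + 4 * (δ / 12)) := by gcongr
    _ = δ := by
        have h12 : δ / 2 = 6 * (δ / 12) := by
          rw [div_eq_mul_inv, div_eq_mul_inv, mul_left_comm]
          congr 1
          rw [show (12 : ℝ≥0∞) = 6 * 2 by norm_num, ENNReal.mul_inv (by simp) (by simp),
            ← mul_assoc, ENNReal.mul_inv_cancel (by simp) (by simp), one_mul]
        have : (12 : ℝ≥0∞) * (δ / 12) = δ := ENNReal.mul_div_cancel (by simp) (by simp)
        rw [h12]
        calc _ = (12 : ℝ≥0∞) * (δ / 12) := by ring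
          _ = δ := this

/-! ### Deterministic estimates along characteristics -/

/-- Grönwall's inequality in differential form, with a continuous nonnegative forcing. -/
theorem le_exp_mul_integral_of_deriv_le {f f' g : ℝ → ℝ} {K T : ℝ} (hK : 0 ≤ K)
    (hf : ∀ t, 0 ≤ t → HasDerivWithinAt f (f' t) (Set.Ici 0) t) (hg : Continuous g)
    (hg0 : ∀ t, 0 ≤ g t) (h : ∀ t, 0 ≤ t → f' t ≤ K * f t + g t) (h0 : f 0 ≤ 0) {t : ℝ}
    (ht : t ∈ Set.Icc 0 T) : f t ≤ Real.exp (K * T) * ∫ s in (0 : ℝ)..T, g s := by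
  have hcont : ContinuousOn f (Set.Icc 0 T) := fun s hs =>
    ((hf s hs.1).continuousWithinAt).mono Set.Icc_subset_Ici_self
  have hexp : ∀ s, HasDerivAt (fun s => Real.exp (-K * s)) (Real.exp (-K * s) * -K) s := fun s => by
    simpa using ((hasDerivAt_id s).const_mul (-K)).exp
  have hB : ∀ s, HasDerivAt (fun r => ∫ s in (0 : ℝ)..r, g s) (g s) s := fun s =>
    intervalIntegral.integral_hasDerivAt_right (hg.intervalIntegrable _ _)
      (hg.stronglyMeasurableAtFilter _ _) hg.continuousAt
  -- The integrating factor `exp (-K t)` removes the linear term.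
  have key : Real.exp (-K * t) * f t ≤ ∫ s in (0 : ℝ)..t, g s := by
    refine image_le_of_deriv_right_le_deriv_boundary (a := 0) (b := T)
      (f := fun s => Real.exp (-K * s) * f s)
      (f' := fun s => Real.exp (-K * s) * -K * f s + Real.exp (-K * s) * f' s)
      (B := fun r => ∫ s in (0 : ℝ)..r, g s) (B' := g) ?_ (fun s hs => ?_) (by simpa using h0) ?_
      (fun s _ => (hB s).hasDerivWithinAt) (fun s hs => ?_) ht
    · exact ContinuousOn.mul (fun s _ => (hexp s).continuousAt.continuousWithinAt) hcont
    · exact (hexp s).hasDerivWithinAt.mul ((hf s hs.1).mono (Set.Ici_subset_Ici.mpr hs.1))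
    · exact fun s _ => (hB s).continuousAt.continuousWithinAt
    · have h1 : Real.exp (-K * s) ≤ 1 := Real.exp_le_one_iff.mpr (by
        rw [neg_mul]; exact neg_nonpos.mpr (mul_nonneg hK hs.1))
      calc Real.exp (-K * s) * -K * f s + Real.exp (-K * s) * f' s
          = Real.exp (-K * s) * (f' s - K * f s) := by ring
        _ ≤ Real.exp (-K * s) * g s :=
          mul_le_mul_of_nonneg_left (by linarith [h s hs.1]) (Real.exp_pos _).le
        _ ≤ g s := mul_le_of_le_one_left (hg0 s) h1
  have hmono : ∫ s in (0 : ℝ)..t, g s ≤ ∫ s in (0 : ℝ)..T, g s :=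
    intervalIntegral.integral_mono_interval le_rfl ht.1 ht.2 (Eventually.of_forall hg0)
      (hg.intervalIntegrable _ _)
  calc f t = Real.exp (K * t) * (Real.exp (-K * t) * f t) := by
        rw [← mul_assoc, ← Real.exp_add]; simp
    _ ≤ Real.exp (K * t) * ∫ s in (0 : ℝ)..T, g s :=
        mul_le_mul_of_nonneg_left (key.trans hmono) (Real.exp_pos _).le
    _ ≤ _ := mul_le_mul_of_nonneg_right
        (Real.exp_le_exp.mpr (mul_le_mul_of_nonneg_left ht.2 hK))
        (intervalIntegral.integral_nonneg (ht.1.trans ht.2) fun s _ => hg0 s)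

/-- A single constant `L` that serves as Lipschitz constant and bound for every ingredient of the
vector field of the characteristic system. The force is bounded uniformly in the mean feature `u`,
so bounds along characteristics do not depend on `u`. -/
structure RegularityBound {B : ℕ} {m n : Fin B → ℕ} {H : Type*} [NormedAddCommGroup H]
    [InnerProductSpace ℝ H] [CompleteSpace H] (F : ParamSpace B m n → H) (R : H → ℝ)
    (ε L : ℝ) : Prop where
  nonneg : 0 ≤ L
  lipschitz_F : ∀ θ ϑ, ‖F θ - F ϑ‖ ≤ L * ‖θ - ϑ‖
  lipschitz_orth : ∀ p q : ParamSpace B m n, ‖orthTheta ε p - orthTheta ε q‖ ≤ L * ‖p - q‖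
  bound_orth : ∀ p : ParamSpace B m n, ‖orthTheta ε p‖ ≤ L
  bound_force : ∀ u θ, ‖force F R u θ‖ ≤ L
  lipschitz_force : ∀ u v θ ϑ,
    ‖force F R u θ - force F R v ϑ‖ ≤ L * ‖θ - ϑ‖ + L * ‖u - v‖

section

variable {B : ℕ} {m n : Fin B → ℕ} {H : Type*} [NormedAddCommGroup H]
  [InnerProductSpace ℝ H] [CompleteSpace H] {F : ParamSpace B m n → H} {R : H → ℝ} {ε γ L : ℝ}

theorem GlobalHilbertSmooth.exists_regularityBound (h : GlobalHilbertSmooth F R) (hε : 0 < ε) :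
    ∃ L, RegularityBound F R ε L := by
  obtain ⟨L₁, h₁⟩ := h.lipschitz_F
  obtain ⟨M₂, h₂⟩ := h.bounded_DF
  obtain ⟨L₃, h₃⟩ := h.lipschitz_DF
  obtain ⟨M₄, h₄⟩ := h.bounded_gradR
  obtain ⟨L₅, h₅⟩ := h.lipschitz_gradR
  obtain ⟨L₆, h₆, h₆'⟩ := exists_lipschitz_orthTheta (m := m) (n := n) hε
  obtain ⟨K₇, h₇, h₇'⟩ := exists_bound_orthTheta m n ε
  have hM₂ : 0 ≤ M₂ := (norm_nonneg _).trans (h₂ 0)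
  have hM₄ : 0 ≤ M₄ := (norm_nonneg _).trans (h₄ 0)
  have e₁ := mul_nonneg (abs_nonneg L₃) hM₄
  have e₂ := mul_nonneg hM₂ (abs_nonneg L₅)
  have e₃ := mul_nonneg hM₂ hM₄
  have e₄ := abs_nonneg L₁
  refine ⟨|L₁| + L₆ + K₇ + M₂ * M₄ + |L₃| * M₄ + M₂ * |L₅|, by positivity, fun θ ϑ => ?_,
    fun p q => ?_, fun p => ?_, fun u θ => ?_, fun u v θ ϑ => ?_⟩
  · refine (h₁ θ ϑ).trans (mul_le_mul_of_nonneg_right ?_ (norm_nonneg _))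
    linarith [le_abs_self L₁]
  · refine (h₆' p q).trans (mul_le_mul_of_nonneg_right ?_ (norm_nonneg _))
    linarith
  · linarith [h₇' p]
  · have : ‖force F R u θ‖ ≤ M₂ * M₄ := by
      refine (ContinuousLinearMap.le_opNorm _ _).trans ?_
      rw [LinearIsometryEquiv.norm_map]
      exact mul_le_mul (h₂ θ) (h₄ u) (norm_nonneg _) hM₂
    linarith
  · have hdec : force F R u θ - force F R v ϑ =
        ContinuousLinearMap.adjoint (fderiv ℝ F θ - fderiv ℝ F ϑ) (gradient R u) +
          ContinuousLinearMap.adjoint (fderiv ℝ F ϑ) (gradient R u - gradient R v) := by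
      rw [force, force, map_sub, map_sub, sub_apply]
      abel
    rw [hdec]
    refine (norm_add_le _ _).trans (add_le_add ?_ ?_)
    · refine (ContinuousLinearMap.le_opNorm _ _).trans ?_
      rw [LinearIsometryEquiv.norm_map]
      have h1 : ‖fderiv ℝ F θ - fderiv ℝ F ϑ‖ ≤ |L₃| * ‖θ - ϑ‖ :=
        (h₃ θ ϑ).trans (mul_le_mul_of_nonneg_right (le_abs_self _) (norm_nonneg _))
      calc _ ≤ |L₃| * ‖θ - ϑ‖ * M₄ := mul_le_mul h1 (h₄ u) (norm_nonneg _) (by positivity)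
        _ = |L₃| * M₄ * ‖θ - ϑ‖ := by ring
        _ ≤ _ := mul_le_mul_of_nonneg_right (by linarith) (norm_nonneg _)
    · refine (ContinuousLinearMap.le_opNorm _ _).trans ?_
      rw [LinearIsometryEquiv.norm_map]
      have h1 : ‖gradient R u - gradient R v‖ ≤ |L₅| * ‖u - v‖ :=
        (h₅ u v).trans (mul_le_mul_of_nonneg_right (le_abs_self _) (norm_nonneg _))
      calc _ ≤ M₂ * (|L₅| * ‖u - v‖) := mul_le_mul (h₂ ϑ) h1 (norm_nonneg _) hM₂
        _ = M₂ * |L₅| * ‖u - v‖ := by ring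
        _ ≤ _ := mul_le_mul_of_nonneg_right (by linarith) (norm_nonneg _)

/-- The parameter component moves with speed at most `L`, whatever the mean feature. -/
theorem SolvesCharacteristic.norm_fst_sub_le (hL : RegularityBound F R ε L) {u : ℝ → H}
    {z : ℝ → PhaseSpace B m n} (hz : SolvesCharacteristic F R ε γ u z) {s t : ℝ} (hs : 0 ≤ s)
    (ht : 0 ≤ t) : ‖(z t).fst - (z s).fst‖ ≤ L * |t - s| :=
  (convex_Ici (0 : ℝ)).norm_image_sub_le_of_norm_hasDerivWithin_le (fun r hr => (hz r hr).1)
    (fun r _ => by rw [norm_neg]; exact hL.bound_orth _) hs ht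

/-- The relaxation term `-p` absorbs the growth of the momentum, up to the bounded force. -/
theorem SolvesCharacteristic.norm_snd_sq_le (hL : RegularityBound F R ε L) (hγ : 0 < γ)
    {u : ℝ → H} {z : ℝ → PhaseSpace B m n} (hz : SolvesCharacteristic F R ε γ u z) {t T : ℝ}
    (ht : t ∈ Set.Icc 0 T) : ‖(z t).snd‖ ^ 2 ≤ ‖(z 0).snd‖ ^ 2 + γ * L ^ 2 * T := by
  have := le_exp_mul_integral_of_deriv_le (K := 0) (T := T) (g := fun _ => γ * L ^ 2) le_rfl
    (f := fun t => ‖(z t).snd‖ ^ 2 - ‖(z 0).snd‖ ^ 2)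
    (f' := fun t => 2 * inner ℝ (z t).snd (γ • (force F R (u t) (z t).fst - (z t).snd)))
    (fun t ht => (hz t ht).2.norm_sq.sub_const _) continuous_const (fun t => by positivity)
    (fun t _ => by
      rw [inner_smul_right, inner_sub_right, real_inner_self_eq_norm_sq]
      have h1 : inner ℝ (z t).snd (force F R (u t) (z t).fst) ≤ ‖(z t).snd‖ * L :=
        (real_inner_le_norm _ _).trans
          (mul_le_mul_of_nonneg_left (hL.bound_force _ _) (norm_nonneg _))
      have h2 : 2 * (inner ℝ (z t).snd (force F R (u t) (z t).fst) - ‖(z t).snd‖ ^ 2) ≤ L ^ 2 := by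
        nlinarith [sq_nonneg (‖(z t).snd‖ - L), sq_nonneg ‖(z t).snd‖]
      nlinarith [mul_le_mul_of_nonneg_left h2 hγ.le]) (by simp) ht
  simp only [zero_mul, Real.exp_zero, one_mul, intervalIntegral.integral_const, sub_zero,
    smul_eq_mul] at this
  linarith

/-- The constant in the quadratic modulus of continuity of characteristics on `[0, T]`. -/
def incrementConst (γ L T : ℝ) : ℝ := L ^ 2 + 2 * γ ^ 2 * (L ^ 2 + γ * L ^ 2 * T + 1)

theorem SolvesCharacteristic.norm_sub_sq_le (hL : RegularityBound F R ε L) (hγ : 0 < γ)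
    {u : ℝ → H} {z : ℝ → PhaseSpace B m n} (hz : SolvesCharacteristic F R ε γ u z) {s t T : ℝ}
    (hs : s ∈ Set.Icc 0 T) (ht : t ∈ Set.Icc 0 T) :
    ‖z t - z s‖ ^ 2 ≤ incrementConst γ L T * (1 + ‖z 0‖ ^ 2) * (t - s) ^ 2 := by
  have hT : 0 ≤ T := hs.1.trans hs.2
  have hL0 := hL.nonneg
  set q := ‖(z 0).snd‖ ^ 2 + γ * L ^ 2 * T with hq
  have hq0 : 0 ≤ q := by positivity
  have h1 := hz.norm_fst_sub_le hL hs.1 ht.1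
  have h2 : ‖(z t).snd - (z s).snd‖ ≤ γ * (L + Real.sqrt q) * ‖t - s‖ := by
    refine (convex_Icc (0 : ℝ) T).norm_image_sub_le_of_norm_hasDerivWithin_le
      (f := fun r => (z r).snd)
      (fun r hr => (hz r hr.1).2.mono Set.Icc_subset_Ici_self) (fun r hr => ?_) hs ht
    rw [norm_smul, Real.norm_of_nonneg hγ.le]
    refine mul_le_mul_of_nonneg_left ?_ hγ.le
    exact (norm_sub_le _ _).trans (add_le_add (hL.bound_force _ _)
      (Real.le_sqrt_of_sq_le (hz.norm_snd_sq_le hL hγ hr)))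
  have h3 : ‖(z t).fst - (z s).fst‖ ^ 2 ≤ L ^ 2 * (t - s) ^ 2 := by
    refine (pow_le_pow_left₀ (norm_nonneg _) h1 2).trans ?_
    rw [mul_pow, sq_abs]
  have h4 : ‖(z t).snd - (z s).snd‖ ^ 2 ≤ 2 * γ ^ 2 * (L ^ 2 + q) * (t - s) ^ 2 := by
    refine (pow_le_pow_left₀ (norm_nonneg _) h2 2).trans ?_
    rw [mul_pow, Real.norm_eq_abs, sq_abs, mul_pow]
    refine mul_le_mul_of_nonneg_right ?_ (sq_nonneg _)
    have h5 := Real.sq_sqrt hq0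
    have h6 : (L + Real.sqrt q) ^ 2 ≤ 2 * (L ^ 2 + q) := by
      nlinarith [sq_nonneg (L - Real.sqrt q)]
    nlinarith [mul_le_mul_of_nonneg_left h6 (sq_nonneg γ)]
  have h7 : ‖(z 0).snd‖ ^ 2 ≤ ‖z 0‖ ^ 2 := by
    rw [WithLp.prod_norm_sq_eq_of_L2]
    nlinarith [sq_nonneg ‖(z 0).fst‖]
  rw [WithLp.prod_norm_sq_eq_of_L2]
  calc ‖(z t - z s).fst‖ ^ 2 + ‖(z t - z s).snd‖ ^ 2
      ≤ L ^ 2 * (t - s) ^ 2 + 2 * γ ^ 2 * (L ^ 2 + q) * (t - s) ^ 2 := add_le_add h3 h4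
    _ = (L ^ 2 + 2 * γ ^ 2 * (L ^ 2 + q)) * (t - s) ^ 2 := by ring
    _ ≤ _ := by
      refine mul_le_mul_of_nonneg_right ?_ (sq_nonneg _)
      have h8 : 0 ≤ (L ^ 2 + 2 * γ ^ 2 * (L ^ 2 + γ * L ^ 2 * T)) * ‖z 0‖ ^ 2 := by positivity
      have h9 := mul_le_mul_of_nonneg_left h7 (by positivity : 0 ≤ 2 * γ ^ 2)
      rw [incrementConst, hq]
      nlinarith [sq_nonneg γ]

/-- Stability of characteristics: the derivative of the squared distance of two solutions is
controlled by the squared distance and by the discrepancy of the mean features. -/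
theorem SolvesCharacteristic.exists_deriv_norm_sub_sq_le (hL : RegularityBound F R ε L)
    (hγ : 0 < γ) {u v : ℝ → H} {x y : ℝ → PhaseSpace B m n}
    (hx : SolvesCharacteristic F R ε γ u x) (hy : SolvesCharacteristic F R ε γ v y) :
    ∃ D' : ℝ → ℝ, ∀ t, 0 ≤ t →
      HasDerivWithinAt (fun s => ‖x s - y s‖ ^ 2) (D' t) (Set.Ici 0) t ∧
        D' t ≤ (L + 2 * γ * L) * ‖x t - y t‖ ^ 2 + γ * L * ‖u t - v t‖ ^ 2 := by
  have hD : ∀ s, ‖x s - y s‖ ^ 2 = ‖(x s).fst - (y s).fst‖ ^ 2 + ‖(x s).snd - (y s).snd‖ ^ 2 :=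
    fun s => WithLp.prod_norm_sq_eq_of_L2 _
  refine ⟨fun t => 2 * inner ℝ ((x t).fst - (y t).fst)
      (-orthTheta ε (x t).snd - -orthTheta ε (y t).snd) +
    2 * inner ℝ ((x t).snd - (y t).snd) (γ • (force F R (u t) (x t).fst - (x t).snd) -
      γ • (force F R (v t) (y t).fst - (y t).snd)), fun t ht => ⟨?_, ?_⟩⟩
  · simp only [hD]
    exact ((hx t ht).1.sub (hy t ht).1).norm_sq.add ((hx t ht).2.sub (hy t ht).2).norm_sq
  · have hL0 := hL.nonneg
    beta_reduce
    rw [hD, neg_sub_neg, ← smul_sub, inner_smul_right]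
    set a := (x t).fst - (y t).fst with ha
    set b := (x t).snd - (y t).snd with hb
    set w := u t - v t with hw
    have h1 : inner ℝ a (orthTheta ε (y t).snd - orthTheta ε (x t).snd) ≤ ‖a‖ * (L * ‖b‖) := by
      refine (real_inner_le_norm _ _).trans (mul_le_mul_of_nonneg_left ?_ (norm_nonneg _))
      rw [hb, norm_sub_rev (x t).snd]
      exact hL.lipschitz_orth _ _
    have h2 : inner ℝ b (force F R (u t) (x t).fst - (x t).snd -
        (force F R (v t) (y t).fst - (y t).snd)) ≤ ‖b‖ * (L * ‖a‖ + L * ‖w‖) := by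
      have : force F R (u t) (x t).fst - (x t).snd - (force F R (v t) (y t).fst - (y t).snd) =
          (force F R (u t) (x t).fst - force F R (v t) (y t).fst) - b := by
        rw [hb]; abel
      rw [this, inner_sub_right, real_inner_self_eq_norm_sq]
      have h3 := (real_inner_le_norm b _).trans (mul_le_mul_of_nonneg_left
        (hL.lipschitz_force (u t) (v t) (x t).fst (y t).fst) (norm_nonneg b))
      nlinarith [sq_nonneg ‖b‖]
    have h4 : 2 * (‖a‖ * (L * ‖b‖)) ≤ L * (‖a‖ ^ 2 + ‖b‖ ^ 2) := by
      nlinarith [mul_nonneg hL0 (sq_nonneg (‖a‖ - ‖b‖))]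
    have h5 : 2 * (‖b‖ * (L * ‖a‖ + L * ‖w‖)) ≤
        2 * L * (‖a‖ ^ 2 + ‖b‖ ^ 2) + L * ‖w‖ ^ 2 := by
      nlinarith [mul_nonneg hL0 (sq_nonneg (‖a‖ - ‖b‖)), mul_nonneg hL0 (sq_nonneg (‖w‖ - ‖b‖)),
        mul_nonneg hL0 (sq_nonneg ‖a‖)]
    have h6 := mul_le_mul_of_nonneg_left h2 hγ.le
    have h7 := mul_le_mul_of_nonneg_left h5 hγ.le
    nlinarith

theorem norm_inv_smul_sum_sq_le {H : Type*} [NormedAddCommGroup H] [NormedSpace ℝ H] {N : ℕ}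
    (w : Fin N → H) :
    ‖(N : ℝ)⁻¹ • ∑ j, w j‖ ^ 2 ≤ (N : ℝ)⁻¹ * ∑ j, ‖w j‖ ^ 2 := by
  rcases Nat.eq_zero_or_pos N with rfl | hN
  · simp
  have hN0 : (0 : ℝ) < N := by exact_mod_cast hN
  have h1 : ‖∑ j, w j‖ ^ 2 ≤ N * ∑ j, ‖w j‖ ^ 2 := by
    refine (pow_le_pow_left₀ (norm_nonneg _) (norm_sum_le _ _) 2).trans ?_
    simpa using sq_sum_le_card_mul_sum_sq (s := (Finset.univ : Finset (Fin N)))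
      (f := fun j => ‖w j‖)
  rw [norm_smul, mul_pow, Real.norm_of_nonneg (by positivity)]
  calc ((N : ℝ)⁻¹) ^ 2 * ‖∑ j, w j‖ ^ 2 ≤ ((N : ℝ)⁻¹) ^ 2 * (N * ∑ j, ‖w j‖ ^ 2) :=
        mul_le_mul_of_nonneg_left h1 (by positivity)
    _ = _ := by field_simp

/-- The growth rate in the pathwise coupling estimate. -/
def couplingRate (γ L : ℝ) : ℝ := L + 2 * γ * L + 4 * (γ * L) * L ^ 2

/-- Pathwise coupling estimate. Grönwall's inequality is applied to the squared distance of the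
`i`-th pair plus the average of the squared distances of all pairs, a quantity which satisfies a
closed inequality forced only by the fluctuation `g` of the empirical mean feature. -/
theorem SolvesParticleODE.norm_sub_sq_le (hL : RegularityBound F R ε L) (hγ : 0 < γ) {N : ℕ}
    {v : ℝ → H} {x y : Fin N → ℝ → PhaseSpace B m n} (hx : SolvesParticleODE F R ε γ x)
    (hy : ∀ i, SolvesCharacteristic F R ε γ v (y i)) (h0 : ∀ i, x i 0 = y i 0) {g : ℝ → ℝ}
    (hg : Continuous g) (hg0 : ∀ t, 0 ≤ g t)
    (hgv : ∀ t, 0 ≤ t → ‖(N : ℝ)⁻¹ • ∑ j, F (y j t).fst - v t‖ ^ 2 ≤ g t) (i : Fin N) {t T : ℝ}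
    (ht : t ∈ Set.Icc 0 T) :
    ‖x i t - y i t‖ ^ 2 ≤
      Real.exp (couplingRate γ L * T) * (4 * (γ * L)) * ∫ s in (0 : ℝ)..T, g s := by
  have hL0 := hL.nonneg
  have hb : 0 ≤ γ * L := by positivity
  set u : ℝ → H := fun t => (N : ℝ)⁻¹ • ∑ j, F (x j t).fst with hu
  choose D' hD' using fun j => (hx j).exists_deriv_norm_sub_sq_le hL hγ (hy j)
  set S : ℝ → ℝ := fun t => (N : ℝ)⁻¹ * ∑ j, ‖x j t - y j t‖ ^ 2 with hS
  have hS0 : ∀ t, 0 ≤ S t := fun t => by positivity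
  have hN0 : (0 : ℝ) < N := by exact_mod_cast i.pos
  have hdisc : ∀ t, 0 ≤ t → ‖u t - v t‖ ^ 2 ≤ 2 * L ^ 2 * S t + 2 * g t := fun t ht => by
    have h1 : u t - v t = (N : ℝ)⁻¹ • ∑ j, (F (x j t).fst - F (y j t).fst) +
        ((N : ℝ)⁻¹ • ∑ j, F (y j t).fst - v t) := by
      rw [hu, Finset.sum_sub_distrib, smul_sub]; abel
    have h2 : ‖(N : ℝ)⁻¹ • ∑ j, (F (x j t).fst - F (y j t).fst)‖ ^ 2 ≤ L ^ 2 * S t := by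
      refine (norm_inv_smul_sum_sq_le _).trans ?_
      have hSt : L ^ 2 * S t = (N : ℝ)⁻¹ * ∑ j, L ^ 2 * ‖x j t - y j t‖ ^ 2 := by
        rw [← Finset.mul_sum, mul_left_comm]
      rw [hSt]
      refine mul_le_mul_of_nonneg_left (Finset.sum_le_sum fun j _ => ?_) (inv_nonneg.mpr hN0.le)
      have h3 := pow_le_pow_left₀ (norm_nonneg _) (hL.lipschitz_F (x j t).fst (y j t).fst) 2
      rw [mul_pow] at h3
      refine h3.trans (mul_le_mul_of_nonneg_left ?_ (sq_nonneg _))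
      rw [WithLp.prod_norm_sq_eq_of_L2]
      exact le_add_of_nonneg_right (sq_nonneg _)
    rw [h1]
    refine (pow_le_pow_left₀ (norm_nonneg _) (norm_add_le _ _) 2).trans ?_
    refine add_sq_le.trans ?_
    linarith [hgv t ht]
  have hSd : ∀ t, 0 ≤ t → HasDerivWithinAt S ((N : ℝ)⁻¹ * ∑ j, D' j t) (Set.Ici 0) t :=
    fun t ht => (HasDerivWithinAt.fun_sum fun j _ => (hD' j t ht).1).const_mul (N : ℝ)⁻¹
  have hDle : ∀ j t, 0 ≤ t → D' j t ≤ (L + 2 * γ * L) * ‖x j t - y j t‖ ^ 2 +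
      γ * L * (2 * L ^ 2 * S t + 2 * g t) := fun j t ht =>
    (hD' j t ht).2.trans (add_le_add le_rfl (mul_le_mul_of_nonneg_left (hdisc t ht) hb))
  have hSle : ∀ t, 0 ≤ t → (N : ℝ)⁻¹ * ∑ j, D' j t ≤ (L + 2 * γ * L) * S t +
      γ * L * (2 * L ^ 2 * S t + 2 * g t) := fun t ht => by
    calc (N : ℝ)⁻¹ * ∑ j, D' j t ≤ (N : ℝ)⁻¹ * ∑ j, ((L + 2 * γ * L) * ‖x j t - y j t‖ ^ 2 +
          γ * L * (2 * L ^ 2 * S t + 2 * g t)) :=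
        mul_le_mul_of_nonneg_left (Finset.sum_le_sum fun j _ => hDle j t ht) (inv_nonneg.mpr hN0.le)
      _ = _ := by
        rw [Finset.sum_add_distrib, ← Finset.mul_sum, Finset.sum_const, Finset.card_univ,
          Fintype.card_fin, nsmul_eq_mul, mul_add, ← mul_assoc (N : ℝ)⁻¹ (N : ℝ),
          inv_mul_cancel₀ hN0.ne', one_mul, mul_left_comm]
  have key := le_exp_mul_integral_of_deriv_le (K := couplingRate γ L) (T := T)
    (g := fun t => 4 * (γ * L) * g t) (f := fun t => ‖x i t - y i t‖ ^ 2 + S t)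
    (f' := fun t => D' i t + (N : ℝ)⁻¹ * ∑ j, D' j t)
    (by rw [couplingRate]; positivity)
    (fun t ht => (hD' i t ht).1.add (hSd t ht)) (continuous_const.mul hg)
    (fun t => mul_nonneg (by positivity) (hg0 t))
    (fun t ht => by
      have h1 := hDle i t ht
      have h2 := hSle t ht
      have h3 : 0 ≤ 4 * (γ * L) * L ^ 2 * ‖x i t - y i t‖ ^ 2 := by positivity
      rw [couplingRate]
      nlinarith) (by simp [hS, h0]) ht
  rw [intervalIntegral.integral_const_mul, ← mul_assoc] at key
  linarith [hS0 t]

end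

/-! ### Estimates for the synchronous coupling -/

section

variable {B : ℕ} {m n : Fin B → ℕ} {H : Type*} [NormedAddCommGroup H]
  [InnerProductSpace ℝ H] [CompleteSpace H] {F : ParamSpace B m n → H} {R : H → ℝ} {ε γ L : ℝ}

theorem edist_phaseSpace_sq (z w : PhaseSpace B m n) :
    edist z w ^ 2 = ‖z.fst - w.fst‖ₑ ^ 2 + ‖z.snd - w.snd‖ₑ ^ 2 := by
  have h := WithLp.prod_norm_sq_eq_of_L2 (z - w)
  rw [edist_eq_enorm_sub, ← ofReal_norm, ← ofReal_norm, ← ofReal_norm,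
    ← ENNReal.ofReal_pow (norm_nonneg _), ← ENNReal.ofReal_pow (norm_nonneg _),
    ← ENNReal.ofReal_pow (norm_nonneg _), h,
    ENNReal.ofReal_add (sq_nonneg _) (sq_nonneg _)]
  rfl

theorem edist_sq_eq_ofReal {E : Type*} [NormedAddCommGroup E] (z w : E) :
    edist z w ^ 2 = ENNReal.ofReal (‖z - w‖ ^ 2) := by
  rw [edist_eq_enorm_sub, ← ofReal_norm, ENNReal.ofReal_pow (norm_nonneg _)]

theorem norm_phaseSpace_fst_le (z : PhaseSpace B m n) : ‖z.fst‖ ≤ ‖z‖ := by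
  refine le_of_sq_le_sq ?_ (norm_nonneg _)
  rw [WithLp.prod_norm_sq_eq_of_L2]
  exact le_add_of_nonneg_right (sq_nonneg _)

theorem RegularityBound.continuous_feature (hL : RegularityBound F R ε L) :
    Continuous fun z : PhaseSpace B m n => F z.fst := by
  have hF : Continuous F := (LipschitzWith.of_dist_le_mul (K := L.toNNReal) fun θ ϑ => by
    rw [dist_eq_norm, dist_eq_norm, Real.coe_toNNReal _ hL.nonneg]
    exact hL.lipschitz_F θ ϑ).continuous
  exact hF.comp (by fun_prop)

variable {μ₀ : Measure (PhaseSpace B m n)} {Ω : Type*} [MeasurableSpace Ω] {Pr : Measure Ω}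
  {Y : ℕ → ℝ → Ω → PhaseSpace B m n} {X : (N : ℕ) → Fin N → ℝ → Ω → PhaseSpace B m n}

/-- The mean feature `E F(θ̄_t)` of the nonlinear copies. -/
noncomputable def meanFeature (F : ParamSpace B m n → H) (Pr : Measure Ω)
    (Y : ℕ → ℝ → Ω → PhaseSpace B m n) (t : ℝ) : H :=
  ∫ ω, F (Y 0 t ω).fst ∂Pr

/-- A bound for the second moment of the features `F(θ̄_t)`, `t ∈ [0, T]`. -/
noncomputable def featureBound (F : ParamSpace B m n → H) (L : ℝ)
    (μ₀ : Measure (PhaseSpace B m n)) (T : ℝ) : ℝ :=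
  3 * ‖F 0‖ ^ 2 + 3 * (L ^ 2 * T) ^ 2 + 3 * L ^ 2 * ∫ z, ‖z‖ ^ 2 ∂μ₀

/-- The constant of the coupling estimate on `[0, T]`: Grönwall's factor times the bound
`T * featureBound` for `N` times the expected time integral of the squared fluctuation. The
truncation `toNNReal` is harmless: for `T < 0` the interval is empty. -/
noncomputable def couplingConst (F : ParamSpace B m n → H) (γ L : ℝ)
    (μ₀ : Measure (PhaseSpace B m n)) (T : ℝ) : ℝ≥0 :=
  (Real.exp (couplingRate γ L * T) * (4 * (γ * L)) * (T * featureBound F L μ₀ T)).toNNReal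

namespace IsSynchronousCoupling

theorem identDistrib_at (hC : IsSynchronousCoupling F R ε γ μ₀ Pr Y X) (i : ℕ) {t : ℝ}
    (ht : 0 ≤ t) : IdentDistrib (Y i t) (Y 0 t) Pr Pr :=
  (hC.identDistrib_copies i).comp (measurable_pi_apply (⟨t, ht⟩ : ℝ≥0))

theorem iIndepFun_at (hC : IsSynchronousCoupling F R ε γ μ₀ Pr Y X) {t : ℝ}
    (ht : 0 ≤ t) : iIndepFun (fun i => Y i t) Pr :=
  hC.indep_copies.comp (fun _ x => x (⟨t, ht⟩ : ℝ≥0)) fun _ => measurable_pi_apply _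

theorem integral_feature (hC : IsSynchronousCoupling F R ε γ μ₀ Pr Y X)
    (hL : RegularityBound F R ε L) (i : ℕ) {t : ℝ} (ht : 0 ≤ t) :
    ∫ ω, F (Y i t ω).fst ∂Pr = meanFeature F Pr Y t := by
  have h := hL.continuous_feature
  rw [meanFeature, ← integral_map (hC.measurable_copy i t ht).aemeasurable
    h.stronglyMeasurable.aestronglyMeasurable, (hC.identDistrib_at i ht).map_eq,
    integral_map (hC.measurable_copy 0 t ht).aemeasurable
    h.stronglyMeasurable.aestronglyMeasurable]

theorem ae_solves (hC : IsSynchronousCoupling F R ε γ μ₀ Pr Y X) (hL : RegularityBound F R ε L) :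
    ∀ᵐ ω ∂Pr, ∀ i, SolvesCharacteristic F R ε γ (meanFeature F Pr Y) fun t => Y i t ω := by
  rw [ae_all_iff]
  intro i
  filter_upwards [hC.copy_solves i] with ω hω t ht
  rw [← hC.integral_feature hL i ht]
  exact hω t ht

theorem memLp_initial (hC : IsSynchronousCoupling F R ε γ μ₀ Pr Y X) (hμ₀ : MemLp id 2 μ₀)
    (i : ℕ) : MemLp (Y i 0) 2 Pr := by
  have h := hC.measurable_copy i 0 le_rfl
  have hmap : Pr.map (Y i 0) = μ₀ := (hC.identDistrib_at i le_rfl).map_eq.trans hC.initial_law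
  rw [← hmap] at hμ₀
  exact (memLp_map_measure_iff measurable_id.aestronglyMeasurable h.aemeasurable).mp hμ₀

theorem integral_norm_sq_initial (hC : IsSynchronousCoupling F R ε γ μ₀ Pr Y X) (i : ℕ) :
    ∫ ω, ‖Y i 0 ω‖ ^ 2 ∂Pr = ∫ z, ‖z‖ ^ 2 ∂μ₀ := by
  have h := hC.measurable_copy i 0 le_rfl
  have hmap : Pr.map (Y i 0) = μ₀ := (hC.identDistrib_at i le_rfl).map_eq.trans hC.initial_law
  rw [← hmap, integral_map h.aemeasurable (by fun_prop)]

variable [IsProbabilityMeasure Pr]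

theorem memLp_feature (hC : IsSynchronousCoupling F R ε γ μ₀ Pr Y X)
    (hL : RegularityBound F R ε L) (hμ₀ : MemLp id 2 μ₀) (i : ℕ) {t T : ℝ}
    (ht : t ∈ Set.Icc 0 T) : MemLp (fun ω => F (Y i t ω).fst) 2 Pr ∧
      ∫ ω, ‖F (Y i t ω).fst‖ ^ 2 ∂Pr ≤ featureBound F L μ₀ T := by
  have hL0 := hL.nonneg
  have hT : 0 ≤ T := ht.1.trans ht.2
  have hm : AEStronglyMeasurable (fun ω => F (Y i t ω).fst) Pr :=
    (hL.continuous_feature.stronglyMeasurable.comp_measurable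
      (hC.measurable_copy i t ht.1)).aestronglyMeasurable
  have hI := integrable_norm_sq_of_memLp (hC.memLp_initial hμ₀ i)
  have hI' : Integrable (fun ω => 3 * ‖F 0‖ ^ 2 + 3 * (L ^ 2 * T) ^ 2 +
      3 * L ^ 2 * ‖Y i 0 ω‖ ^ 2) Pr := (integrable_const _).add (hI.const_mul _)
  have hle : ∀ᵐ ω ∂Pr, ‖F (Y i t ω).fst‖ ^ 2 ≤ 3 * ‖F 0‖ ^ 2 + 3 * (L ^ 2 * T) ^ 2 +
      3 * L ^ 2 * ‖Y i 0 ω‖ ^ 2 := by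
    filter_upwards [hC.ae_solves hL] with ω hω
    have h1 := (hω i).norm_fst_sub_le hL le_rfl ht.1
    rw [sub_zero, abs_of_nonneg ht.1] at h1
    have h2 : ‖(Y i t ω).fst‖ ≤ ‖Y i 0 ω‖ + L * T := by
      calc ‖(Y i t ω).fst‖ = ‖(Y i 0 ω).fst + ((Y i t ω).fst - (Y i 0 ω).fst)‖ := by
            rw [add_sub_cancel]
        _ ≤ ‖Y i 0 ω‖ + L * T := (norm_add_le _ _).trans (add_le_add (norm_phaseSpace_fst_le _)
            (h1.trans (mul_le_mul_of_nonneg_left ht.2 hL0)))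
    have h3 : ‖F (Y i t ω).fst‖ ≤ ‖F 0‖ + L ^ 2 * T + L * ‖Y i 0 ω‖ := by
      have h4 := hL.lipschitz_F (Y i t ω).fst 0
      rw [sub_zero] at h4
      have h5 := norm_le_norm_add_norm_sub' (F (Y i t ω).fst) (F 0)
      nlinarith [mul_le_mul_of_nonneg_left h2 hL0]
    refine (pow_le_pow_left₀ (norm_nonneg _) h3 2).trans ?_
    nlinarith [sq_nonneg (‖F 0‖ - L ^ 2 * T), sq_nonneg (‖F 0‖ - L * ‖Y i 0 ω‖),
      sq_nonneg (L ^ 2 * T - L * ‖Y i 0 ω‖)]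
  have hIF : Integrable (fun ω => ‖F (Y i t ω).fst‖ ^ 2) Pr :=
    hI'.mono' (hm.norm.pow 2) (hle.mono fun ω h => by
      rwa [Real.norm_of_nonneg (sq_nonneg _)])
  refine ⟨(memLp_two_iff_integrable_sq_norm hm).mpr hIF, (integral_mono_ae hIF hI' hle).trans ?_⟩
  rw [integral_add (integrable_const _) (hI.const_mul _), integral_const_mul,
    hC.integral_norm_sq_initial, featureBound]
  simp

/-- Increments in time of the nonlinear copies, in quadratic mean. -/
theorem lintegral_edist_sq_copy_le (hC : IsSynchronousCoupling F R ε γ μ₀ Pr Y X)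
    (hL : RegularityBound F R ε L) (hγ : 0 < γ) (hμ₀ : MemLp id 2 μ₀) (i : ℕ) {s t T : ℝ}
    (hs : s ∈ Set.Icc 0 T) (ht : t ∈ Set.Icc 0 T) :
    ∫⁻ ω, edist (Y i t ω) (Y i s ω) ^ 2 ∂Pr ≤
      ENNReal.ofReal (incrementConst γ L T * (1 + ∫ z, ‖z‖ ^ 2 ∂μ₀) * (t - s) ^ 2) := by
  have hI := integrable_norm_sq_of_memLp (hC.memLp_initial hμ₀ i)
  have hI' : Integrable (fun ω => incrementConst γ L T * (1 + ‖Y i 0 ω‖ ^ 2) * (t - s) ^ 2) Pr :=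
    (((integrable_const _).add hI).const_mul _).mul_const _
  have hint : ∫ ω, incrementConst γ L T * (1 + ‖Y i 0 ω‖ ^ 2) * (t - s) ^ 2 ∂Pr =
      incrementConst γ L T * (1 + ∫ z, ‖z‖ ^ 2 ∂μ₀) * (t - s) ^ 2 := by
    rw [integral_mul_const, integral_const_mul, integral_add (integrable_const _) hI,
      hC.integral_norm_sq_initial]
    simp
  have hle : ∀ᵐ ω ∂Pr, ‖Y i t ω - Y i s ω‖ ^ 2 ≤
      incrementConst γ L T * (1 + ‖Y i 0 ω‖ ^ 2) * (t - s) ^ 2 := by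
    filter_upwards [hC.ae_solves hL] with ω hω
    exact (hω i).norm_sub_sq_le hL hγ hs ht
  rw [← hint, ofReal_integral_eq_lintegral_ofReal hI'
    (hle.mono fun ω h => (sq_nonneg _).trans h)]
  refine lintegral_mono_ae (hle.mono fun ω h => ?_)
  rw [edist_sq_eq_ofReal]
  exact ENNReal.ofReal_le_ofReal h

theorem memLp_at (hC : IsSynchronousCoupling F R ε γ μ₀ Pr Y X)
    (hL : RegularityBound F R ε L) (hγ : 0 < γ) (hμ₀ : MemLp id 2 μ₀) (i : ℕ) {t : ℝ}
    (ht : 0 ≤ t) : MemLp (Y i t) 2 Pr := by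
  have h0 := hC.memLp_initial hμ₀ i
  have hm : AEStronglyMeasurable (Y i t - Y i 0) Pr :=
    (hC.measurable_copy i t ht).aestronglyMeasurable.sub h0.1
  have hd : MemLp (Y i t - Y i 0) 2 Pr := by
    refine ⟨hm, ?_⟩
    have h1 := hC.lintegral_edist_sq_copy_le hL hγ hμ₀ i (T := t) ⟨le_rfl, ht⟩ ⟨ht, le_rfl⟩
    have h2 : eLpNorm (Y i t - Y i 0) 2 Pr ^ 2 < ∞ := by
      rw [← lintegral_enorm_sq_eq_eLpNorm_sq]
      simp only [edist_eq_enorm_sub] at h1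
      exact h1.trans_lt ENNReal.ofReal_lt_top
    exact lt_top_iff_ne_top.mpr fun h => by simp [h] at h2
  simpa using hd.add h0

theorem continuousOn_meanFeature (hC : IsSynchronousCoupling F R ε γ μ₀ Pr Y X)
    (hL : RegularityBound F R ε L) (hμ₀ : MemLp id 2 μ₀) :
    ContinuousOn (meanFeature F Pr Y) (Set.Ici 0) := by
  have hL0 := hL.nonneg
  refine (LipschitzOnWith.of_dist_le_mul (K := (L * L).toNNReal) fun t ht s hs => ?_).continuousOn
  have hI : ∀ r, 0 ≤ r → Integrable (fun ω => F (Y 0 r ω).fst) Pr := fun r hr =>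
    (hC.memLp_feature hL hμ₀ 0 (T := r) ⟨hr, le_rfl⟩).1.integrable one_le_two
  rw [dist_eq_norm, meanFeature, meanFeature, ← integral_sub (hI t ht) (hI s hs),
    Real.coe_toNNReal _ (mul_nonneg hL0 hL0)]
  refine (norm_integral_le_of_norm_le_const (C := L * L * dist t s) ?_).trans (by simp)
  filter_upwards [hC.ae_solves hL] with ω hω
  rw [mul_assoc]
  exact (hL.lipschitz_F _ _).trans
    (mul_le_mul_of_nonneg_left ((hω 0).norm_fst_sub_le hL hs ht) hL0)

/-- The fluctuation of the empirical mean feature of `N` independent copies. -/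
theorem integral_fluctuation_le (hC : IsSynchronousCoupling F R ε γ μ₀ Pr Y X)
    (hL : RegularityBound F R ε L) (hμ₀ : MemLp id 2 μ₀) {N : ℕ} (hN : 1 ≤ N) {t T : ℝ}
    (ht : t ∈ Set.Icc 0 T) :
    Integrable (fun ω => ‖(N : ℝ)⁻¹ • ∑ j : Fin N, F (Y j t ω).fst - meanFeature F Pr Y t‖ ^ 2)
        Pr ∧
      ∫ ω, ‖(N : ℝ)⁻¹ • ∑ j : Fin N, F (Y j t ω).fst - meanFeature F Pr Y t‖ ^ 2 ∂Pr ≤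
        featureBound F L μ₀ T / N := by
  borelize H
  exact integral_norm_average_sub_sq_le hN (ξ := fun (j : Fin N) ω => F (Y j t ω).fst)
    (fun j => (hC.memLp_feature hL hμ₀ j ht).1)
    (fun i j hij => ((hC.iIndepFun_at ht.1).indepFun (Fin.val_injective.ne hij)).comp
      hL.continuous_feature.measurable hL.continuous_feature.measurable)
    (fun j => hC.integral_feature hL j ht.1) (fun j => (hC.memLp_feature hL hμ₀ j ht).2)

/-- The coupling estimate: the pathwise bound is integrated, and Tonelli's theorem moves the
expectation inside the time integral of the fluctuation. -/
theorem lintegral_edist_sq_le (hC : IsSynchronousCoupling F R ε γ μ₀ Pr Y X)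
    (hL : RegularityBound F R ε L) (hγ : 0 < γ) (hμ₀ : MemLp id 2 μ₀) {N : ℕ} (hN : 1 ≤ N)
    (i : Fin N) {t T : ℝ} (ht : t ∈ Set.Icc 0 T) :
    ∫⁻ ω, edist (X N i t ω) (Y i t ω) ^ 2 ∂Pr ≤ (couplingConst F γ L μ₀ T : ℝ≥0∞) / N := by
  have hL0 := hL.nonneg
  have hT : 0 ≤ T := ht.1.trans ht.2
  have hN0 : (0 : ℝ) < N := by exact_mod_cast hN
  set v := meanFeature F Pr Y with hv
  set A := Real.exp (couplingRate γ L * T) * (4 * (γ * L)) with hA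
  have hA0 : 0 ≤ A := by positivity
  -- The fluctuation, frozen at its initial value for negative times.
  set g : ℝ → Ω → ℝ := fun s ω =>
    ‖(N : ℝ)⁻¹ • ∑ j : Fin N, F (Y j (max s 0) ω).fst - v (max s 0)‖ ^ 2 with hg
  have hg0 : ∀ s ω, 0 ≤ g s ω := fun s ω => sq_nonneg _
  have hmax : Continuous fun s : ℝ => max s 0 := continuous_id.max continuous_const
  have hvc : Continuous fun s => v (max s 0) :=
    (hC.continuousOn_meanFeature hL hμ₀).comp_continuous hmax fun _ =>
      Set.mem_Ici.mpr (le_max_right _ _)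
  have hgood : ∀ᵐ ω ∂Pr, (∀ j, SolvesCharacteristic F R ε γ v fun t => Y j t ω) ∧
      SolvesParticleODE F R ε γ (fun j t => X N j t ω) ∧ ∀ j : Fin N, X N j 0 ω = Y j 0 ω := by
    filter_upwards [hC.ae_solves hL, hC.particle_solves N,
      ae_all_iff.mpr (hC.same_initial_data N)] with ω h1 h2 h3
    exact ⟨h1, h2, h3⟩
  -- Outside a measurable null set the fluctuation is continuous in time.
  obtain ⟨Z, hZ, hZm, hZ0⟩ := exists_measurable_superset_of_null (ae_iff.mp hgood)
  have hgoodZ : ∀ ω ∈ Zᶜ, (∀ j, SolvesCharacteristic F R ε γ v fun t => Y j t ω) ∧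
      SolvesParticleODE F R ε γ (fun j t => X N j t ω) ∧ ∀ j : Fin N, X N j 0 ω = Y j 0 ω :=
    fun ω hω => by_contra fun h => hω (hZ h)
  have haeZ : ∀ᵐ ω ∂Pr, ω ∈ Zᶜ := measure_eq_zero_iff_ae_notMem.mp hZ0
  have hgc : ∀ ω ∈ Zᶜ, Continuous fun s => g s ω := fun ω hω => by
    have h1 : ∀ j : Fin N, Continuous fun s => F (Y j (max s 0) ω).fst := fun j => by
      have h2 : ContinuousOn (fun s => F (Y j s ω).fst) (Set.Ici 0) := by
        refine (LipschitzOnWith.of_dist_le_mul (K := (L * L).toNNReal)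
          fun t ht s hs => ?_).continuousOn
        rw [dist_eq_norm, Real.coe_toNNReal _ (mul_nonneg hL0 hL0), mul_assoc]
        exact (hL.lipschitz_F _ _).trans (mul_le_mul_of_nonneg_left
          (((hgoodZ ω hω).1 j).norm_fst_sub_le hL hs ht) hL0)
      exact h2.comp_continuous hmax fun _ => Set.mem_Ici.mpr (le_max_right _ _)
    exact ((((continuous_finsetSum _ fun j _ => h1 j).const_smul _).sub hvc).norm).pow 2
  set g' : ℝ → Ω → ℝ := fun s => Zᶜ.indicator (g s) with hg'
  have hgm : ∀ s, Measurable (g s) := fun s => by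
    have h1 : ∀ j ∈ (Finset.univ : Finset (Fin N)),
        StronglyMeasurable fun ω => F (Y j (max s 0) ω).fst := fun j _ =>
      hL.continuous_feature.stronglyMeasurable.comp_measurable
        (hC.measurable_copy j _ (le_max_right _ _))
    have h2 : StronglyMeasurable fun ω => ∑ j : Fin N, F (Y j (max s 0) ω).fst :=
      Finset.stronglyMeasurable_fun_sum _ h1
    exact (((h2.const_smul (N : ℝ)⁻¹).sub stronglyMeasurable_const).norm.pow 2).measurable
  have hg'm : Measurable (Function.uncurry g') := by
    refine measurable_uncurry_of_continuous_of_measurable (fun ω => ?_)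
      fun s => (hgm s).indicator hZm.compl
    by_cases hω : ω ∈ Zᶜ
    · simpa only [hg', Set.indicator_of_mem hω] using hgc ω hω
    · simpa only [hg', Set.indicator_of_notMem hω] using continuous_const
  have hpath : ∀ ω ∈ Zᶜ, edist (X N i t ω) (Y i t ω) ^ 2 ≤
      ENNReal.ofReal A * ∫⁻ s in Set.Ioc 0 T, ENNReal.ofReal (g' s ω) := fun ω hω => by
    obtain ⟨h1, h2, h3⟩ := hgoodZ ω hω
    have h4 := h2.norm_sub_sq_le hL hγ (v := v) (y := fun j t => Y j t ω) (fun j => h1 j) h3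
      (hgc ω hω) (fun s => hg0 s ω) (fun s hs => by simp only [hg, max_eq_left hs, le_refl]) i ht
    rw [edist_sq_eq_ofReal]
    refine (ENNReal.ofReal_le_ofReal h4).trans (le_of_eq ?_)
    rw [ENNReal.ofReal_mul hA0, intervalIntegral.integral_of_le hT,
      ofReal_integral_eq_lintegral_ofReal
        (((hgc ω hω).intervalIntegrable 0 T).1) (Eventually.of_forall fun s => hg0 s ω)]
    simp only [hg', Set.indicator_of_mem hω]
  have hslice : ∀ s ∈ Set.Ioc 0 T, ∫⁻ ω, ENNReal.ofReal (g' s ω) ∂Pr ≤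
      ENNReal.ofReal (featureBound F L μ₀ T / N) := fun s hs => by
    obtain ⟨h1, h2⟩ := hC.integral_fluctuation_le hL hμ₀ hN (T := T) ⟨hs.1.le, hs.2⟩
    refine le_trans ?_ (ENNReal.ofReal_le_ofReal h2)
    rw [ofReal_integral_eq_lintegral_ofReal h1 (Eventually.of_forall fun ω => sq_nonneg _)]
    refine lintegral_mono fun ω => ENNReal.ofReal_le_ofReal ?_
    refine (Set.indicator_le_self' (fun _ _ => hg0 s _) ω).trans (le_of_eq ?_)
    simp only [hg, max_eq_left hs.1.le, hv]
  have hsw : AEMeasurable (Function.uncurry fun ω s => ENNReal.ofReal (g' s ω))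
      (Pr.prod (volume.restrict (Set.Ioc 0 T))) :=
    ((hg'm.comp measurable_swap).ennreal_ofReal).aemeasurable
  calc ∫⁻ ω, edist (X N i t ω) (Y i t ω) ^ 2 ∂Pr
      ≤ ∫⁻ ω, (ENNReal.ofReal A * ∫⁻ s in Set.Ioc 0 T, ENNReal.ofReal (g' s ω)) ∂Pr :=
        lintegral_mono_ae (haeZ.mono hpath)
    _ = ENNReal.ofReal A * ∫⁻ s in Set.Ioc 0 T, ∫⁻ ω, ENNReal.ofReal (g' s ω) ∂Pr := by
        rw [lintegral_const_mul' _ _ ENNReal.ofReal_ne_top, lintegral_lintegral_swap hsw]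
    _ ≤ ENNReal.ofReal A * ∫⁻ _s in Set.Ioc 0 T, ENNReal.ofReal (featureBound F L μ₀ T / N) := by
        exact mul_le_mul' le_rfl (setLIntegral_mono measurable_const hslice)
    _ = ENNReal.ofReal (A * (T * featureBound F L μ₀ T) / N) := by
        rw [setLIntegral_const, Real.volume_Ioc, sub_zero, mul_comm (ENNReal.ofReal (_ / _)),
          ← ENNReal.ofReal_mul hT, ← ENNReal.ofReal_mul hA0]
        congr 1
        ring
    _ = (couplingConst F γ L μ₀ T : ℝ≥0∞) / N := by
        rw [ENNReal.ofReal_div_of_pos hN0, ENNReal.ofReal_natCast]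
        rfl

end IsSynchronousCoupling

end

/-! ### Convergence of the particle laws and of the empirical measures -/

section

variable {B : ℕ} {m n : Fin B → ℕ} {H : Type*} [NormedAddCommGroup H]
  [InnerProductSpace ℝ H] [CompleteSpace H] {F : ParamSpace B m n → H} {R : H → ℝ} {ε γ L : ℝ}
  {μ₀ : Measure (PhaseSpace B m n)} {Ω : Type*} [MeasurableSpace Ω] {Pr : Measure Ω}
  {Y : ℕ → ℝ → Ω → PhaseSpace B m n} {X : (N : ℕ) → Fin N → ℝ → Ω → PhaseSpace B m n}
  [IsProbabilityMeasure Pr]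

theorem edist_piLp_sq {E : Type*} [SeminormedAddCommGroup E] {k : ℕ}
    (x y : PiLp 2 fun _ : Fin k => E) : edist x y ^ 2 = ∑ j, edist (x j) (y j) ^ 2 := by
  rw [PiLp.edist_eq_of_L2, ← ENNReal.rpow_natCast, ← ENNReal.rpow_mul]
  simp

theorem measurable_toLp_pi {E : Type*} [MeasurableSpace E] {k : ℕ} {f : Fin k → Ω → E}
    (hf : ∀ j, Measurable (f j)) :
    Measurable fun ω => (WithLp.toLp 2 fun j => f j ω : PiLp 2 fun _ : Fin k => E) :=
  (WithLp.measurable_toLp 2 _).comp (measurable_pi_lambda _ hf)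

theorem tendsto_const_div_natCast_add (c : ℝ≥0∞) (hc : c ≠ ∞) (N₀ : ℕ) :
    Tendsto (fun M : ℕ => c / ((N₀ + M : ℕ) : ℝ≥0∞)) atTop (𝓝 0) := by
  have h1 : Tendsto (fun M : ℕ => N₀ + M) atTop atTop :=
    tendsto_atTop_mono (fun M => Nat.le_add_left M N₀) tendsto_id
  have h2 := ENNReal.Tendsto.const_div (a := c) (ENNReal.tendsto_nat_nhds_top.comp h1)
    (Or.inr hc)
  simpa using h2

namespace IsSynchronousCoupling

/-- The joint law of `k` distinct nonlinear copies is the product measure. -/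
theorem map_tuple_copy (hC : IsSynchronousCoupling F R ε γ μ₀ Pr Y X) {k N : ℕ}
    (e : Fin k ↪ Fin N) {t : ℝ} (ht : 0 ≤ t) :
    (Pr.map fun ω => (WithLp.toLp 2 fun j : Fin k => Y (e j) t ω :
      PiLp 2 fun _ : Fin k => PhaseSpace B m n)) = tensorPower (Pr.map (Y 0 t)) k := by
  have hm : ∀ j : Fin k, Measurable (Y (e j) t) := fun j => hC.measurable_copy _ t ht
  have hind : iIndepFun (fun j : Fin k => Y (e j) t) Pr :=
    (hC.iIndepFun_at ht).precomp (g := fun j : Fin k => ((e j : Fin N) : ℕ))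
      (Fin.val_injective.comp e.injective)
  have h := (iIndepFun_iff_map_fun_eq_pi_map fun j => (hm j).aemeasurable).mp hind
  simp only [(hC.identDistrib_at _ ht).map_eq] at h
  rw [tensorPower, ← h, Measure.map_map (WithLp.measurable_toLp 2 _) (measurable_pi_lambda _ hm)]
  rfl

theorem lintegral_edist_tuple_sq_le (hC : IsSynchronousCoupling F R ε γ μ₀ Pr Y X)
    (hL : RegularityBound F R ε L) (hγ : 0 < γ) (hμ₀ : MemLp id 2 μ₀) {k N : ℕ} (hN : 1 ≤ N)
    (e : Fin k ↪ Fin N) {t T : ℝ} (ht : t ∈ Set.Icc 0 T) :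
    ∫⁻ ω, edist (WithLp.toLp 2 fun j : Fin k => X N (e j) t ω :
        PiLp 2 fun _ : Fin k => PhaseSpace B m n)
      (WithLp.toLp 2 fun j : Fin k => Y (e j) t ω) ^ 2 ∂Pr ≤
      (k : ℝ≥0∞) * couplingConst F γ L μ₀ T / N := by
  simp only [edist_piLp_sq]
  rw [lintegral_finsetSum _ fun j _ => ((hC.measurable_particle N (e j) t ht.1).edist
    (hC.measurable_copy (e j) t ht.1)).pow_const 2]
  refine (Finset.sum_le_sum fun j _ => hC.lintegral_edist_sq_le hL hγ hμ₀ hN (e j) ht).trans ?_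
  simp [mul_div_assoc]

theorem wasserstein2Sq_tuple_le (hC : IsSynchronousCoupling F R ε γ μ₀ Pr Y X)
    (hL : RegularityBound F R ε L) (hγ : 0 < γ) (hμ₀ : MemLp id 2 μ₀) {k N : ℕ} (hN : 1 ≤ N)
    (e : Fin k ↪ Fin N) {t T : ℝ} (ht : t ∈ Set.Icc 0 T) :
    wasserstein2Sq (Pr.map fun ω => WithLp.toLp 2 fun j : Fin k => X N (e j) t ω)
      (tensorPower (Pr.map (Y 0 t)) k) ≤ (k : ℝ≥0∞) * couplingConst F γ L μ₀ T / N := by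
  rw [← hC.map_tuple_copy e ht.1]
  exact (wasserstein2Sq_map_le Pr
    (measurable_toLp_pi fun j => hC.measurable_particle N (e j) t ht.1)
    (measurable_toLp_pi fun j => hC.measurable_copy (e j) t ht.1)).trans
    (hC.lintegral_edist_tuple_sq_le hL hγ hμ₀ hN e ht)

/-- Convergence in law of `k` fixed particles: the coupled tuples converge in `L²`, hence in
measure. -/
theorem tendsto_integral_tuple (hC : IsSynchronousCoupling F R ε γ μ₀ Pr Y X)
    (hL : RegularityBound F R ε L) (hγ : 0 < γ) (hμ₀ : MemLp id 2 μ₀) {k N₀ : ℕ}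
    (e : Fin k ↪ Fin N₀) {t : ℝ} (ht : 0 ≤ t)
    (φ : BoundedContinuousFunction (PiLp 2 fun _ : Fin k => PhaseSpace B m n) ℝ) :
    Tendsto (fun M : ℕ => ∫ ω, φ (WithLp.toLp 2 fun j : Fin k =>
        X (N₀ + M) (Fin.castAdd M (e j)) t ω) ∂Pr)
      atTop (𝓝 (∫ z, φ z ∂(tensorPower (Pr.map (Y 0 t)) k))) := by
  set U : ℕ → Ω → PiLp 2 fun _ : Fin k => PhaseSpace B m n := fun M ω =>
    WithLp.toLp 2 fun j : Fin k => X (N₀ + M) (Fin.castAdd M (e j)) t ω with hU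
  set V : Ω → PiLp 2 fun _ : Fin k => PhaseSpace B m n := fun ω =>
    WithLp.toLp 2 fun j : Fin k => Y (e j) t ω with hV
  have hUm : ∀ M, Measurable (U M) := fun M =>
    measurable_toLp_pi fun j => hC.measurable_particle _ _ t ht
  have hVm : Measurable V := measurable_toLp_pi fun j => hC.measurable_copy _ t ht
  have hlim : Tendsto (fun M => eLpNorm (U M - V) 2 Pr ^ 2) atTop (𝓝 0) := by
    refine tendsto_of_tendsto_of_tendsto_of_le_of_le' tendsto_const_nhds
      (tendsto_const_div_natCast_add ((k : ℝ≥0∞) * couplingConst F γ L μ₀ t)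
        (ENNReal.mul_ne_top (ENNReal.natCast_ne_top k) ENNReal.coe_ne_top) N₀)
      (Eventually.of_forall fun _ => zero_le) ?_
    filter_upwards [eventually_ge_atTop 1] with M hM
    rw [← lintegral_enorm_sq_eq_eLpNorm_sq]
    have := hC.lintegral_edist_tuple_sq_le hL hγ hμ₀ (N := N₀ + M) (by omega)
      (e.trans (Fin.castAddEmb M)) (T := t) ⟨ht, le_rfl⟩
    simp only [edist_eq_enorm_sub] at this
    exact this
  have hlim' : Tendsto (fun M => eLpNorm (U M - V) 2 Pr) atTop (𝓝 0) := by
    have h := (ENNReal.continuous_rpow_const (y := 1 / 2)).tendsto 0 |>.comp hlim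
    rw [ENNReal.zero_rpow_of_pos (by norm_num)] at h
    refine h.congr fun M => ?_
    rw [Function.comp_apply, ← ENNReal.rpow_natCast, ← ENNReal.rpow_mul]
    norm_num
  have hmeas : TendstoInMeasure Pr U atTop V :=
    tendstoInMeasure_of_tendsto_eLpNorm two_ne_zero
      (fun M => (hUm M).aestronglyMeasurable) hVm.aestronglyMeasurable hlim'
  have hdist := (hmeas.tendstoInDistribution fun M => (hUm M).aemeasurable).tendsto
  have h := ProbabilityMeasure.tendsto_iff_forall_integral_tendsto.mp hdist φ
  simp only [ProbabilityMeasure.coe_mk] at h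
  rw [← hC.map_tuple_copy e ht]
  refine h.congr fun M => ?_
  exact integral_map (hUm M).aemeasurable φ.continuous.aestronglyMeasurable

theorem lintegral_wasserstein2Sq_empirical_le (hC : IsSynchronousCoupling F R ε γ μ₀ Pr Y X)
    (hL : RegularityBound F R ε L) (hγ : 0 < γ) (hμ₀ : MemLp id 2 μ₀) {N : ℕ} (hN : 1 ≤ N)
    {t T : ℝ} (ht : t ∈ Set.Icc 0 T) :
    ∫⁻ ω, wasserstein2Sq (empiricalMeasure fun i => X N i t ω) (Pr.map (Y 0 t)) ∂Pr ≤
      2 * (couplingConst F γ L μ₀ T : ℝ≥0∞) / N + 2 * ∫⁻ ω,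
        wasserstein2Sq (empiricalMeasure fun i : Fin N => Y i t ω) (Pr.map (Y 0 t)) ∂Pr := by
  have hN0 : (N : ℝ≥0∞) ≠ 0 := by exact_mod_cast Nat.one_le_iff_ne_zero.mp hN
  have hm : ∀ i ∈ (Finset.univ : Finset (Fin N)),
      Measurable fun ω => edist (X N i t ω) (Y i t ω) ^ 2 := fun i _ =>
    ((hC.measurable_particle N i t ht.1).edist (hC.measurable_copy i t ht.1)).pow_const 2
  have hm' : Measurable fun ω => 2 * ((N : ℝ≥0∞)⁻¹ * ∑ i, edist (X N i t ω) (Y i t ω) ^ 2) :=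
    ((Finset.measurable_sum _ hm).const_mul _).const_mul _
  calc ∫⁻ ω, wasserstein2Sq (empiricalMeasure fun i => X N i t ω) (Pr.map (Y 0 t)) ∂Pr
      ≤ ∫⁻ ω, (2 * ((N : ℝ≥0∞)⁻¹ * ∑ i, edist (X N i t ω) (Y i t ω) ^ 2) +
          2 * wasserstein2Sq (empiricalMeasure fun i : Fin N => Y i t ω)
            (Pr.map (Y 0 t))) ∂Pr := by
        refine lintegral_mono fun ω => ?_
        have := isProbabilityMeasure_empiricalMeasure hN fun i : Fin N => Y i t ω
        refine (wasserstein2Sq_triangle _ (empiricalMeasure fun i : Fin N => Y i t ω) _).trans ?_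
        gcongr
        exact wasserstein2Sq_empiricalMeasure_le _ _
    _ ≤ _ := by
        rw [lintegral_add_left hm', lintegral_const_mul' _ _ ENNReal.ofNat_ne_top,
          lintegral_const_mul' _ _ ENNReal.ofNat_ne_top,
          lintegral_const_mul' _ _ (ENNReal.inv_ne_top.mpr hN0), lintegral_finsetSum _ hm,
          mul_div_assoc]
        gcongr
        calc (N : ℝ≥0∞)⁻¹ * ∑ i : Fin N, ∫⁻ ω, edist (X N i t ω) (Y i t ω) ^ 2 ∂Pr
            ≤ (N : ℝ≥0∞)⁻¹ * ∑ _i : Fin N, (couplingConst F γ L μ₀ T : ℝ≥0∞) / N := by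
              gcongr with i
              exact hC.lintegral_edist_sq_le hL hγ hμ₀ hN i ht
          _ = _ := by
              rw [Finset.sum_const, Finset.card_univ, Fintype.card_fin, nsmul_eq_mul, ← mul_assoc,
                ENNReal.inv_mul_cancel hN0 (ENNReal.natCast_ne_top N), one_mul]

/-- Comparison of the empirical errors of the copies at two times. -/
theorem lintegral_wasserstein2Sq_copy_le_add (hC : IsSynchronousCoupling F R ε γ μ₀ Pr Y X)
    (hL : RegularityBound F R ε L) (hγ : 0 < γ) (hμ₀ : MemLp id 2 μ₀) {N : ℕ} (hN : 1 ≤ N)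
    {s t T : ℝ} (hs : s ∈ Set.Icc 0 T) (ht : t ∈ Set.Icc 0 T) :
    ∫⁻ ω, wasserstein2Sq (empiricalMeasure fun i : Fin N => Y i t ω) (Pr.map (Y 0 t)) ∂Pr ≤
      6 * ENNReal.ofReal (incrementConst γ L T * (1 + ∫ z, ‖z‖ ^ 2 ∂μ₀) * (t - s) ^ 2) +
      4 * ∫⁻ ω, wasserstein2Sq (empiricalMeasure fun i : Fin N => Y i s ω)
        (Pr.map (Y 0 s)) ∂Pr := by
  set c := ENNReal.ofReal (incrementConst γ L T * (1 + ∫ z, ‖z‖ ^ 2 ∂μ₀) * (t - s) ^ 2) with hc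
  have hN0 : (N : ℝ≥0∞) ≠ 0 := by exact_mod_cast Nat.one_le_iff_ne_zero.mp hN
  have hinc : ∀ i, ∫⁻ ω, edist (Y i t ω) (Y i s ω) ^ 2 ∂Pr ≤ c := fun i =>
    hC.lintegral_edist_sq_copy_le hL hγ hμ₀ i hs ht
  have hm : ∀ i ∈ (Finset.univ : Finset (Fin N)),
      Measurable fun ω => edist (Y i t ω) (Y i s ω) ^ 2 := fun i _ =>
    ((hC.measurable_copy i t ht.1).edist (hC.measurable_copy i s hs.1)).pow_const 2
  have hm' : Measurable fun ω =>
      2 * ((N : ℝ≥0∞)⁻¹ * ∑ i : Fin N, edist (Y i t ω) (Y i s ω) ^ 2) :=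
    ((Finset.measurable_sum _ hm).const_mul _).const_mul _
  have hlaw : wasserstein2Sq (Pr.map (Y 0 s)) (Pr.map (Y 0 t)) ≤ c := by
    refine (wasserstein2Sq_map_le Pr (hC.measurable_copy 0 s hs.1)
      (hC.measurable_copy 0 t ht.1)).trans ?_
    simpa only [edist_comm] using hinc 0
  have hprob := Measure.isProbabilityMeasure_map (μ := Pr)
    (hC.measurable_copy 0 s hs.1).aemeasurable
  calc ∫⁻ ω, wasserstein2Sq (empiricalMeasure fun i : Fin N => Y i t ω) (Pr.map (Y 0 t)) ∂Pr
      ≤ ∫⁻ ω, (2 * ((N : ℝ≥0∞)⁻¹ * ∑ i : Fin N, edist (Y i t ω) (Y i s ω) ^ 2) +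
          2 * (2 * wasserstein2Sq (empiricalMeasure fun i : Fin N => Y i s ω)
            (Pr.map (Y 0 s)) + 2 * c)) ∂Pr := by
        refine lintegral_mono fun ω => ?_
        have := isProbabilityMeasure_empiricalMeasure hN fun i : Fin N => Y i s ω
        refine (wasserstein2Sq_triangle _ (empiricalMeasure fun i : Fin N => Y i s ω) _).trans ?_
        gcongr
        · exact wasserstein2Sq_empiricalMeasure_le _ _
        · refine (wasserstein2Sq_triangle _ (Pr.map (Y 0 s)) _).trans ?_
          gcongr
    _ ≤ 2 * c + 2 * (2 * ∫⁻ ω, wasserstein2Sq (empiricalMeasure fun i : Fin N => Y i s ω)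
            (Pr.map (Y 0 s)) ∂Pr + 2 * c) := by
        rw [lintegral_add_left hm', lintegral_const_mul' _ _ ENNReal.ofNat_ne_top,
          lintegral_const_mul' _ _ ENNReal.ofNat_ne_top,
          lintegral_const_mul' _ _ (ENNReal.inv_ne_top.mpr hN0), lintegral_finsetSum _ hm,
          lintegral_add_right _ measurable_const, lintegral_const_mul' _ _ ENNReal.ofNat_ne_top,
          lintegral_const, measure_univ, mul_one]
        gcongr
        calc (N : ℝ≥0∞)⁻¹ * ∑ i : Fin N, ∫⁻ ω, edist (Y i t ω) (Y i s ω) ^ 2 ∂Pr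
            ≤ (N : ℝ≥0∞)⁻¹ * ∑ _i : Fin N, c := by
              gcongr with i
              exact hinc i
          _ = c := by
              rw [Finset.sum_const, Finset.card_univ, Fintype.card_fin, nsmul_eq_mul, ← mul_assoc,
                ENNReal.inv_mul_cancel hN0 (ENNReal.natCast_ne_top N), one_mul]
    _ = _ := by ring

/-- The law of large numbers for the empirical measures of the copies, uniformly in time: the
convergence at each time propagates to a neighbourhood, and `[0, T]` is compact. -/
theorem tendsto_iSup_lintegral_wasserstein2Sq_copy
    (hC : IsSynchronousCoupling F R ε γ μ₀ Pr Y X)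
    (hL : RegularityBound F R ε L) (hγ : 0 < γ) (hμ₀ : MemLp id 2 μ₀) (T : ℝ) :
    Tendsto (fun N : ℕ => ⨆ t ∈ Set.Icc 0 T, ∫⁻ ω, wasserstein2Sq
      (empiricalMeasure fun i : Fin N => Y i t ω) (Pr.map (Y 0 t)) ∂Pr) atTop (𝓝 0) := by
  rw [ENNReal.tendsto_nhds_zero]
  intro δ hδ
  have hδ2 : 0 < δ / 2 := ENNReal.half_pos hδ.ne'
  suffices h : ∀ᶠ N : ℕ in atTop, ∀ t ∈ Set.Icc 0 T, ∫⁻ ω, wasserstein2Sq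
      (empiricalMeasure fun i : Fin N => Y i t ω) (Pr.map (Y 0 t)) ∂Pr ≤ δ from
    h.mono fun N hN => iSup₂_le hN
  have key := isCompact_Icc (a := (0 : ℝ)) (b := T) |>.induction_on
    (p := fun S => ∀ᶠ N : ℕ in atTop, ∀ t ∈ S, t ∈ Set.Icc 0 T → ∫⁻ ω, wasserstein2Sq
      (empiricalMeasure fun i : Fin N => Y i t ω) (Pr.map (Y 0 t)) ∂Pr ≤ δ)
    (by simp) (fun S S' hSS' h => h.mono fun N hN t ht => hN t (hSS' ht))
    (fun S S' h h' => by
      filter_upwards [h, h'] with N hN hN' t ht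
      exact ht.elim (hN t) (hN' t))
    (fun s hs => by
      have hlim := tendsto_lintegral_wasserstein2Sq_empiricalMeasure (P := Pr)
        (Y := fun i => Y i s) (fun i => hC.measurable_copy i s hs.1)
        (fun i j hij => (hC.iIndepFun_at hs.1).indepFun hij)
        (fun i => hC.identDistrib_at i hs.1) (hC.memLp_at hL hγ hμ₀ 0 hs.1)
      have hlim4 := ENNReal.Tendsto.const_mul (a := 4) hlim (Or.inr ENNReal.ofNat_ne_top)
      rw [mul_zero] at hlim4
      have hcont : Continuous fun t : ℝ => 6 * ENNReal.ofReal
          (incrementConst γ L T * (1 + ∫ z, ‖z‖ ^ 2 ∂μ₀) * (t - s) ^ 2) :=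
        (ENNReal.continuous_const_mul ENNReal.ofNat_ne_top).comp
          (ENNReal.continuous_ofReal.comp (by fun_prop))
      have hnear : ∀ᶠ t in 𝓝 s, 6 * ENNReal.ofReal
          (incrementConst γ L T * (1 + ∫ z, ‖z‖ ^ 2 ∂μ₀) * (t - s) ^ 2) < δ / 2 :=
        hcont.continuousAt.eventually_lt_const (by simpa using hδ2)
      refine ⟨_, mem_nhdsWithin_of_mem_nhds hnear, ?_⟩
      filter_upwards [eventually_ge_atTop 1, ENNReal.tendsto_nhds_zero.mp hlim4 _ hδ2]
        with N hN hNδ t htn ht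
      refine (hC.lintegral_wasserstein2Sq_copy_le_add hL hγ hμ₀ hN hs ht).trans ?_
      calc _ ≤ δ / 2 + δ / 2 := add_le_add (le_of_lt htn) hNδ
        _ = δ := ENNReal.add_halves δ)
  exact key.mono fun N hN t ht => hN t ht ht

end IsSynchronousCoupling

end

theorem mainTheorem5 {B : ℕ} {m n : Fin B → ℕ} {H : Type*} [NormedAddCommGroup H]
    [InnerProductSpace ℝ H] [CompleteSpace H] (F : ParamSpace B m n → H) (R : H → ℝ)
    (hFR : GlobalHilbertSmooth F R) (ε γ : ℝ) (hε : 0 < ε) (hγ : 0 < γ)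
    (μ₀ : Measure (PhaseSpace B m n)) [IsProbabilityMeasure μ₀] (hμ₀ : MemLp id 2 μ₀) (T : ℝ) :
    ∃ C : ℝ≥0, ∀ (Ω : Type*) [MeasurableSpace Ω] (Pr : Measure Ω) [IsProbabilityMeasure Pr]
      (Y : ℕ → ℝ → Ω → PhaseSpace B m n)
      (X : (N : ℕ) → Fin N → ℝ → Ω → PhaseSpace B m n),
      IsSynchronousCoupling F R ε γ μ₀ Pr Y X →
      ∀ μ : ℝ → Measure (PhaseSpace B m n), (∀ t, 0 ≤ t → μ t = Pr.map (Y 0 t)) →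
      -- the coupling estimate
      (∀ N : ℕ, 1 ≤ N → ∀ i : Fin N,
        (⨆ t ∈ Set.Icc 0 T, ∫⁻ ω, (‖(X N i t ω).fst - (Y i t ω).fst‖ₑ ^ 2
          + ‖(X N i t ω).snd - (Y i t ω).snd‖ₑ ^ 2) ∂Pr) ≤ (C : ℝ≥0∞) / N) ∧
      -- any `k` distinct particles: rate in squared Wasserstein distance
      (∀ (k N : ℕ), 1 ≤ N → ∀ e : Fin k ↪ Fin N,
        (⨆ t ∈ Set.Icc 0 T, wasserstein2Sq
          (Pr.map fun ω => WithLp.toLp 2 fun j : Fin k => X N (e j) t ω)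
          (tensorPower (μ t) k)) ≤ (k : ℝ≥0∞) * C / N) ∧
      -- any `k` fixed particles: convergence as the number of particles tends to infinity,
      -- in Wasserstein distance uniformly on `[0, T]`, and in law
      (∀ (k N₀ : ℕ) (e : Fin k ↪ Fin N₀),
        Tendsto (fun M : ℕ => ⨆ t ∈ Set.Icc 0 T, wasserstein2Sq
          (Pr.map fun ω => WithLp.toLp 2 fun j : Fin k => X (N₀ + M) (Fin.castAdd M (e j)) t ω)
          (tensorPower (μ t) k)) atTop (𝓝 0) ∧
        ∀ t ∈ Set.Icc 0 T,
          ∀ φ : BoundedContinuousFunction (PiLp 2 fun _ : Fin k => PhaseSpace B m n) ℝ,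
            Tendsto (fun M : ℕ => ∫ ω, φ (WithLp.toLp 2 fun j : Fin k =>
                X (N₀ + M) (Fin.castAdd M (e j)) t ω) ∂Pr)
              atTop (𝓝 (∫ z, φ z ∂(tensorPower (μ t) k)))) ∧
      -- empirical measures: estimate and convergence in expected squared Wasserstein distance
      (∀ N : ℕ, 1 ≤ N →
        (⨆ t ∈ Set.Icc 0 T, ∫⁻ ω, wasserstein2Sq (empiricalMeasure fun i => X N i t ω) (μ t) ∂Pr)
          ≤ 2 * (C : ℝ≥0∞) / N + 2 * (⨆ t ∈ Set.Icc 0 T, ∫⁻ ω,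
            wasserstein2Sq (empiricalMeasure fun i : Fin N => Y i t ω) (μ t) ∂Pr)) ∧
      Tendsto (fun N : ℕ => ⨆ t ∈ Set.Icc 0 T, ∫⁻ ω,
        wasserstein2Sq (empiricalMeasure fun i : Fin N => Y i t ω) (μ t) ∂Pr) atTop (𝓝 0) ∧
      Tendsto (fun N : ℕ => ⨆ t ∈ Set.Icc 0 T, ∫⁻ ω,
        wasserstein2Sq (empiricalMeasure fun i => X N i t ω) (μ t) ∂Pr) atTop (𝓝 0) := by
  obtain ⟨L, hL⟩ := hFR.exists_regularityBound hε
  refine ⟨couplingConst F γ L μ₀ T, fun Ω _ Pr _ Y X hC μ hμ => ?_⟩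
  have hCtop : (couplingConst F γ L μ₀ T : ℝ≥0∞) ≠ ∞ := ENNReal.coe_ne_top
  have htuple : ∀ (k N : ℕ), 1 ≤ N → ∀ e : Fin k ↪ Fin N,
      (⨆ t ∈ Set.Icc 0 T, wasserstein2Sq
        (Pr.map fun ω => WithLp.toLp 2 fun j : Fin k => X N (e j) t ω)
        (tensorPower (μ t) k)) ≤ (k : ℝ≥0∞) * couplingConst F γ L μ₀ T / N :=
    fun k N hN e => iSup₂_le fun t ht => by
      rw [hμ t ht.1]
      exact hC.wasserstein2Sq_tuple_le hL hγ hμ₀ hN e ht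
  have hcopy : Tendsto (fun N : ℕ => ⨆ t ∈ Set.Icc 0 T, ∫⁻ ω,
      wasserstein2Sq (empiricalMeasure fun i : Fin N => Y i t ω) (μ t) ∂Pr) atTop (𝓝 0) := by
    refine (hC.tendsto_iSup_lintegral_wasserstein2Sq_copy hL hγ hμ₀ T).congr fun N => ?_
    exact iSup_congr fun t => iSup_congr fun ht => by rw [hμ t ht.1]
  have hemp : ∀ N : ℕ, 1 ≤ N →
      (⨆ t ∈ Set.Icc 0 T, ∫⁻ ω, wasserstein2Sq (empiricalMeasure fun i => X N i t ω) (μ t) ∂Pr)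
        ≤ 2 * (couplingConst F γ L μ₀ T : ℝ≥0∞) / N + 2 * (⨆ t ∈ Set.Icc 0 T, ∫⁻ ω,
          wasserstein2Sq (empiricalMeasure fun i : Fin N => Y i t ω) (μ t) ∂Pr) :=
    fun N hN => iSup₂_le fun t ht => by
      refine le_trans ?_ (add_le_add le_rfl (mul_le_mul_right (le_iSup₂ (f := fun t
        (_ : t ∈ Set.Icc 0 T) => ∫⁻ ω, wasserstein2Sq
          (empiricalMeasure fun i : Fin N => Y i t ω) (μ t) ∂Pr) t ht) 2))
      rw [hμ t ht.1]
      exact hC.lintegral_wasserstein2Sq_empirical_le hL hγ hμ₀ hN ht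
  refine ⟨fun N hN i => iSup₂_le fun t ht => ?_, htuple, fun k N₀ e => ⟨?_, fun t ht φ => ?_⟩,
    hemp, hcopy, ?_⟩
  · simp only [← edist_phaseSpace_sq]
    exact hC.lintegral_edist_sq_le hL hγ hμ₀ hN i ht
  · refine tendsto_of_tendsto_of_tendsto_of_le_of_le' tendsto_const_nhds
      (tendsto_const_div_natCast_add ((k : ℝ≥0∞) * couplingConst F γ L μ₀ T)
        (ENNReal.mul_ne_top (ENNReal.natCast_ne_top k) hCtop) N₀)
      (Eventually.of_forall fun _ => zero_le) ?_
    filter_upwards [eventually_ge_atTop 1] with M hM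
    exact htuple k (N₀ + M) (by omega) (e.trans (Fin.castAddEmb M))
  · rw [hμ t ht.1]
    exact hC.tendsto_integral_tuple hL hγ hμ₀ e ht.1 φ
  · have h1 := tendsto_const_div_natCast_add (2 * (couplingConst F γ L μ₀ T : ℝ≥0∞))
      (ENNReal.mul_ne_top ENNReal.ofNat_ne_top hCtop) 0
    have h2 := ENNReal.Tendsto.const_mul (a := 2) hcopy (Or.inr ENNReal.ofNat_ne_top)
    have h3 := h1.add h2
    simp only [zero_add, mul_zero] at h3
    refine tendsto_of_tendsto_of_tendsto_of_le_of_le' tendsto_const_nhds h3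
      (Eventually.of_forall fun _ => zero_le) ?_
    filter_upwards [eventually_ge_atTop 1] with N hN
    exact hemp N hN
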